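/- Let $n\ge 2$. There is a function $C:\mathbb{R}^5\to(0,\infty)$, depending only on $n$ and nondecreasing in each argument, with the following property. Let $\Omega\subset\mathbb{R}^n$ be a bounded convex domain with smooth boundary, and let $\Gamma\subset\Omega$ be either a single point or a (closed, non-degenerate) straight line segment. Let $f\in C^{1,1}(\overline\Omega)$ with $f>0$ in $\overline\Omega$, and let $u$ be a convex function on $\overline\Omega$ with $u\in C^2(\overline\Omega\setminus\Gamma)\cap C^4(\Omega\setminus\Gamma)$ such that $$\det\nabla^2u=f\quad\text{in }\Omega\setminus\Gamma .$$ Then the quantities $\|\nabla\log f\|_{L^\infty(\Omega)}$, $\|\nabla^2\log f\|_{L^\infty(\Omega)}$, $\|\nabla u\|_{L^\infty(\Omega)}$ and $\|\nabla^2u\|_{L^\infty(\partial\Omega)}$ are finite, and for every $x\in\Omega\setminus\Gamma$ $$|\nabla^2u(x)|\le\frac{C}{\operatorname{dist}(x,\Gamma)},$$ where $C=C\big(\operatorname{diam}\Omega,\ \|\nabla\log f\|_{L^\infty(\Omega)},\ \|\nabla^2\log f\|_{L^\infty(\Omega)},\ \|\nabla u\|_{L^\infty(\Omega)},\ \|\nabla^2u\|_{L^\infty(\partial\Omega)}\big)$.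 In particular $C$ depends only on $n$ and these five quantities, and not on $x$. Here $|\nabla^2u|$ is the operator norm. -/

import Mathlib

open MeasureTheory
open scoped Gradient ContDiff NNReal

/-- `Ω` has smooth boundary: near each boundary point, `Ω` is the sublevel set of a smooth
function whose differential does not vanish at that point. -/
def HasSmoothBoundary {n : ℕ} (Ω : Set (EuclideanSpace ℝ (Fin n))) : Prop :=
  ∀ p ∈ frontier Ω, ∃ (U : Set (EuclideanSpace ℝ (Fin n))) (ρ : EuclideanSpace ℝ (Fin n) → ℝ),
    IsOpen U ∧ p ∈ U ∧ ContDiffOn ℝ ∞ ρ U ∧ fderiv ℝ ρ p ≠ 0 ∧ Ω ∩ U = {x ∈ U | ρ x < 0}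

/-- `f` is of class `C^{1,1}` on the closed set `s` (used for the closure of a convex domain):
it is `C¹` up to the boundary and its differential is Lipschitz. -/
def IsC11On {n : ℕ} (f : EuclideanSpace ℝ (Fin n) → ℝ) (s : Set (EuclideanSpace ℝ (Fin n))) :
    Prop :=
  ContDiffOn ℝ 1 f s ∧ ∃ K : ℝ≥0, LipschitzOnWith K (fderivWithin ℝ f s) s

/-- The Hessian matrix `(∂ᵢ∂ⱼ u(x))`. -/
noncomputable def hessianMatrix {n : ℕ} (u : EuclideanSpace ℝ (Fin n) → ℝ)
    (x : EuclideanSpace ℝ (Fin n)) : Matrix (Fin n) (Fin n) ℝ :=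
  Matrix.of fun i j =>
    iteratedFDeriv ℝ 2 u x ![EuclideanSpace.single i 1, EuclideanSpace.single j 1]

/-- `‖∇v‖_{L^∞(Ω)}`. -/
noncomputable def gradSupNorm {n : ℕ} (v : EuclideanSpace ℝ (Fin n) → ℝ)
    (Ω : Set (EuclideanSpace ℝ (Fin n))) : ENNReal :=
  eLpNorm (fun x => ∇ v x) ⊤ (volume.restrict Ω)

/-- `‖∇²v‖_{L^∞(Ω)}`, with the operator norm of the second derivative. -/
noncomputable def hessSupNorm {n : ℕ} (v : EuclideanSpace ℝ (Fin n) → ℝ)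
    (Ω : Set (EuclideanSpace ℝ (Fin n))) : ENNReal :=
  eLpNorm (fun x => iteratedFDeriv ℝ 2 v x) ⊤ (volume.restrict Ω)

/-- `‖∇²v‖_{L^∞(∂Ω)}` for `v` that is `C²` up to `∂Ω`: the supremum over `∂Ω` of the norm of the
second derivative taken from within the closure of `Ω`. -/
noncomputable def hessBoundarySupNorm {n : ℕ} (v : EuclideanSpace ℝ (Fin n) → ℝ)
    (Ω : Set (EuclideanSpace ℝ (Fin n))) : ENNReal :=
  ⨆ x ∈ frontier Ω, ‖iteratedFDerivWithin ℝ 2 v (closure Ω) x‖ₑ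

/-! This is a Pogorelov-type estimate with an affine cut-off. A point `x` outside the closed convex
set `Γ` is separated from it by a hyperplane orthogonal to the shortest segment from `x` to `Γ`.
Pushed off `Γ` by `ε`, it gives an affine `l` that is negative on `Γ` and equals `dist(x, Γ) - ε` at
`x`. On the compact cap `closure Ω ∩ {l ≥ 0}`, which misses `Γ`, one maximises `l * u_ξξ * exp(|∇u|²
/ 2)` over points and unit directions `ξ`.

A positive maximum cannot lie on `l = 0`; on `∂Ω` it is controlled by the boundary Hessian. At an
interior maximum, diagonalise `∇²u` with eigenvalues `λ_i`, the largest being `λ_o`. The second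
order conditions, divided by `λ_i` and summed, are combined with the first and second derivatives of
`log det ∇²u = log f`. The third derivatives from the concavity of `log det` more than absorb those
from `log u_oo`. By the first order condition the surplus cancels the dangerous terms `(l_i / l)² /
λ_i` for `i ≠ o`. Since `l` is affine it contributes no second derivatives, and a quadratic
inequality for `l * λ_o` remains, with coefficients depending only on the data. Letting `ε → 0`
gives the claim.

The algebra is in `pogorelov_algebra`, the maximum point is treated in `sq_le_of_isLocalMax`, the
cap in `mul_hess_le_of_halfSpace`, and `norm_hess_le_hessBound_div` assembles the estimate.
Finiteness of the norms comes from compactness and, for `∇u` near `Γ`, from local Lipschitz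
continuity of convex functions. -/

open Filter Topology

/-! ### Maximum conditions in one variable -/

/-- Necessary first and second order conditions at a local maximum of a function of one variable. -/
theorem IsLocalMax.hasDerivAt_eq_zero_and_nonpos {φ φ' : ℝ → ℝ} {a c : ℝ} (h : IsLocalMax φ a)
    (h1 : ∀ᶠ t in 𝓝 a, HasDerivAt φ (φ' t) t) (h2 : HasDerivAt φ' c a) : φ' a = 0 ∧ c ≤ 0 := by
  have h0 : φ' a = 0 := h.hasDerivAt_eq_zero h1.self_of_nhds
  refine ⟨h0, ?_⟩
  by_contra! hc
  have hd : deriv φ =ᶠ[𝓝 a] φ' := h1.mono fun t ht => ht.deriv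
  have hdd : deriv (deriv φ) a = c := by rw [hd.deriv_eq, h2.deriv]
  -- A positive second derivative would make `a` a local minimum as well, so `φ` would be locally
  -- constant and its second derivative zero.
  have hmin : IsLocalMin φ a := isLocalMin_of_deriv_deriv_pos (by rw [hdd]; exact hc)
    (by rw [hd.self_of_nhds, h0]) h1.self_of_nhds.continuousAt
  have hconst : φ =ᶠ[𝓝 a] fun _ => φ a := by
    filter_upwards [h, hmin] with t ht ht' using le_antisymm ht ht'
  have : deriv φ =ᶠ[𝓝 a] fun _ => 0 := by
    filter_upwards [hconst.eventuallyEq_nhds] with t ht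
    rw [ht.deriv_eq]; simp
  rw [this.deriv_eq] at hdd
  simp at hdd
  exact hc.ne hdd

/-- First and second order conditions at a local maximum of `log L + log W + ½ ∑ Pₖ²` with `L`
affine. -/
theorem IsLocalMax.log_add_log_add_sum_sq {ι : Type*} [Fintype ι] {L W W' : ℝ → ℝ}
    {P P' : ι → ℝ → ℝ} {m w'' a : ℝ} {p'' : ι → ℝ}
    (hL : ∀ t, HasDerivAt L m t) (hL0 : 0 < L a)
    (hW : ∀ᶠ t in 𝓝 a, HasDerivAt W (W' t) t) (hW0 : 0 < W a) (hW' : HasDerivAt W' w'' a)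
    (hP : ∀ k, ∀ᶠ t in 𝓝 a, HasDerivAt (P k) (P' k t) t)
    (hP' : ∀ k, HasDerivAt (P' k) (p'' k) a)
    (h : IsLocalMax (fun t => Real.log (L t) + Real.log (W t) + (∑ k, P k t ^ 2) / 2) a) :
    m / L a + W' a / W a + ∑ k, P k a * P' k a = 0 ∧
    -(m / L a) ^ 2 + (w'' / W a - (W' a / W a) ^ 2) + ∑ k, (P' k a ^ 2 + P k a * p'' k) ≤ 0 := by
  have hLe : ∀ᶠ t in 𝓝 a, 0 < L t := (hL a).continuousAt.eventually_const_lt hL0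
  have hWe : ∀ᶠ t in 𝓝 a, 0 < W t :=
    hW.self_of_nhds.continuousAt.eventually_const_lt hW0
  refine h.hasDerivAt_eq_zero_and_nonpos
    (φ' := fun t => m / L t + W' t / W t + ∑ k, P k t * P' k t) ?_ ?_
  · filter_upwards [hLe, hWe, hW, eventually_all.2 hP] with t h1 h2 h3 h4
    have hs : HasDerivAt (fun t => (∑ k, P k t ^ 2) / 2) (∑ k, P k t * P' k t) t := by
      have := (HasDerivAt.fun_sum (u := Finset.univ) fun k _ => (h4 k).fun_pow 2).div_const 2
      refine this.congr_deriv ?_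
      rw [Finset.sum_div]
      refine Finset.sum_congr rfl fun k _ => ?_
      push_cast
      ring
    exact (((hL t).log h1.ne').add (h3.log h2.ne')).add hs
  · have e1 := (hasDerivAt_const a m).fun_div (hL a) hL0.ne'
    have e2 := hW'.fun_div hW.self_of_nhds hW0.ne'
    have e3 := HasDerivAt.fun_sum (u := Finset.univ) fun k _ =>
      ((hP k).self_of_nhds.fun_mul (hP' k))
    refine ((e1.add e2).add e3).congr_deriv ?_
    congr 1
    · congr 1
      · field_simp; ring
      · field_simp
    · refine Finset.sum_congr rfl fun k _ => ?_
      ring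

/-! ### Derivatives of the logarithm of a determinant -/

section LogDet

variable {ι : Type*} [Fintype ι] [DecidableEq ι]

/-- The Jacobi formula for the derivative of a determinant. -/
theorem Matrix.hasDerivAt_det {M : ℝ → Matrix ι ι ℝ} {M' : Matrix ι ι ℝ} {a : ℝ}
    (h : ∀ i j, HasDerivAt (fun t => M t i j) (M' i j) a) :
    HasDerivAt (fun t => (M t).det) ((M a).adjugate * M').trace a := by
  have h1 : HasDerivAt (fun t => ∑ σ : Equiv.Perm ι, ((Equiv.Perm.sign σ : ℤ) : ℝ) *
      ∏ i, M t (σ i) i) (∑ σ : Equiv.Perm ι, ((Equiv.Perm.sign σ : ℤ) : ℝ) *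
      ∑ i, (∏ j ∈ Finset.univ.erase i, M a (σ j) j) • M' (σ i) i) a :=
    HasDerivAt.fun_sum fun σ _ => (HasDerivAt.fun_finsetProd fun i _ => h (σ i) i).const_mul _
  have h2 : (fun t => (M t).det) = fun t => ∑ σ : Equiv.Perm ι, ((Equiv.Perm.sign σ : ℤ) : ℝ) *
      ∏ i, M t (σ i) i := by
    funext t; rw [Matrix.det_apply']
  rw [h2]
  refine h1.congr_deriv ?_
  -- Cramer's rule: each diagonal entry is the determinant with one column differentiated, matching
  -- the product rule applied to the Leibniz expansion.
  have h3 : ∀ i, ((M a).adjugate * M') i i = ((M a).updateCol i (M'.col i)).det := by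
    intro i
    rw [← Matrix.cramer_apply, Matrix.cramer_eq_adjugate_mulVec]
    rfl
  simp only [Matrix.trace, Matrix.diag_apply, h3, Matrix.det_apply']
  rw [Finset.sum_comm]
  refine Finset.sum_congr rfl fun σ _ => ?_
  rw [Finset.mul_sum]
  refine Finset.sum_congr rfl fun i _ => ?_
  congr 1
  rw [← Finset.mul_prod_erase _ _ (Finset.mem_univ i), smul_eq_mul, mul_comm]
  congr 1
  · simp
  · refine Finset.prod_congr rfl fun j hj => ?_
    rw [Matrix.updateCol_ne (Finset.ne_of_mem_erase hj)]

/-- Derivative of the entries of the inverse matrix. -/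
theorem Matrix.hasDerivAt_inv_apply {M : ℝ → Matrix ι ι ℝ} {M' : Matrix ι ι ℝ} {a : ℝ}
    (h : ∀ i j, HasDerivAt (fun t => M t i j) (M' i j) a) (hdet : (M a).det ≠ 0) (i j : ι) :
    HasDerivAt (fun t => (M t)⁻¹ i j) (-((M a)⁻¹ * M' * (M a)⁻¹) i j) a := by
  -- A submultiplicative norm is needed only for the derivative of ring inversion; the entries are
  -- then read off coordinatewise.
  open scoped Matrix.Norms.Operator in
  have hu : IsUnit (M a) := (Matrix.isUnit_iff_isUnit_det _).2 (isUnit_iff_ne_zero.2 hdet)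
  have hMa : HasDerivAt M M' a := hasDerivAt_pi.2 fun i => hasDerivAt_pi.2 fun j => h i j
  have hinv : (↑(hu.unit⁻¹) : Matrix ι ι ℝ) = (M a)⁻¹ := by
    rw [Matrix.coe_units_inv, IsUnit.unit_spec]
  have := (hasFDerivAt_ringInverse (𝕜 := ℝ) hu.unit).comp_hasDerivAt_of_eq a hMa rfl
  rw [hinv] at this
  have h2 := hasDerivAt_pi.1 (hasDerivAt_pi.1 this i) j
  simp only [Function.comp_apply, ← Matrix.nonsing_inv_eq_ringInverse] at h2
  exact h2

/-- First and second derivative of `log det M` along a curve of matrices at a point where `M` is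
diagonal and positive. -/
theorem Matrix.log_det_deriv_two {M M' : ℝ → Matrix ι ι ℝ} {M'' : Matrix ι ι ℝ} {a : ℝ}
    {lam : ι → ℝ} {H H' : ℝ → ℝ} {h'' : ℝ}
    (hM : ∀ i j, ∀ᶠ t in 𝓝 a, HasDerivAt (fun t => M t i j) (M' t i j) t)
    (hM' : ∀ i j, HasDerivAt (fun t => M' t i j) (M'' i j) a)
    (h0 : M a = Matrix.diagonal lam) (hlam : ∀ i, 0 < lam i)
    (hH : ∀ᶠ t in 𝓝 a, Real.log (M t).det = H t)
    (hH1 : ∀ᶠ t in 𝓝 a, HasDerivAt H (H' t) t) (hH2 : HasDerivAt H' h'' a) :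
    ∑ i, M' a i i / lam i = H' a ∧
    ∑ i, M'' i i / lam i - ∑ i, ∑ j, M' a i j * M' a j i / (lam i * lam j) = h'' := by
  have hMe : ∀ᶠ t in 𝓝 a, ∀ i j, HasDerivAt (fun t => M t i j) (M' t i j) t :=
    eventually_all.2 fun i => eventually_all.2 fun j => hM i j
  have hdet0 : (M a).det ≠ 0 := by
    rw [h0, Matrix.det_diagonal]
    exact (Finset.prod_pos fun i _ => hlam i).ne'
  have hdete : ∀ᶠ t in 𝓝 a, (M t).det ≠ 0 :=
    (Matrix.hasDerivAt_det hMe.self_of_nhds).continuousAt.eventually_ne hdet0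
  have hinv0 : (M a)⁻¹ = Matrix.diagonal fun i => (lam i)⁻¹ := by
    refine Matrix.inv_eq_right_inv ?_
    rw [h0, Matrix.diagonal_mul_diagonal, ← Matrix.diagonal_one]
    congr 1
    funext i
    exact mul_inv_cancel₀ (hlam i).ne'
  -- Jacobi's formula is needed on a neighbourhood, not just at `a`, so that it can be
  -- differentiated again. The derivative of the inverse then produces the quadratic term.
  have hH'e : ∀ᶠ t in 𝓝 a, H' t = ((M t)⁻¹ * M' t).trace := by
    filter_upwards [hMe, hdete, hH.eventually_nhds, hH1] with t h1 h2 h3 h4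
    have h5 := (Matrix.hasDerivAt_det h1).log h2
    have h6 : HasDerivAt H (((M t).adjugate * M' t).trace / (M t).det) t :=
      h5.congr_of_eventuallyEq (h3.mono fun s hs => hs.symm)
    rw [h4.unique h6, Matrix.inv_def, Ring.inverse_eq_inv', Matrix.smul_mul, Matrix.trace_smul,
      smul_eq_mul, div_eq_inv_mul]
  constructor
  · rw [hH'e.self_of_nhds, hinv0]
    simp [Matrix.trace, Matrix.diagonal_mul, div_eq_inv_mul]
  · have hN := Matrix.hasDerivAt_inv_apply hMe.self_of_nhds hdet0
    have hs : HasDerivAt (fun t => ∑ i, ∑ j, (M t)⁻¹ i j * M' t j i)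
        (∑ i, ∑ j, (-((M a)⁻¹ * M' a * (M a)⁻¹) i j * M' a j i + (M a)⁻¹ i j * M'' j i)) a :=
      HasDerivAt.fun_sum fun i _ => HasDerivAt.fun_sum fun j _ => (hN i j).fun_mul (hM' j i)
    have hs' : HasDerivAt H' _ a := hs.congr_of_eventuallyEq (hH'e.mono fun t ht => by
      rw [ht]; simp [Matrix.trace, Matrix.mul_apply])
    rw [hH2.unique hs', hinv0]
    simp only [Matrix.mul_diagonal, Matrix.diagonal_mul, Finset.sum_add_distrib,
      Matrix.diagonal_apply, ite_mul, zero_mul, Finset.sum_ite_eq, Finset.mem_univ, if_true]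
    rw [add_comm, sub_eq_add_neg, ← Finset.sum_neg_distrib]
    congr 1
    · exact Finset.sum_congr rfl fun i _ => div_eq_inv_mul _ _
    · refine Finset.sum_congr rfl fun i _ => ?_
      rw [← Finset.sum_neg_distrib]
      refine Finset.sum_congr rfl fun j _ => ?_
      rw [div_eq_mul_inv, mul_inv]
      ring

end LogDet

/-! ### Iterated directional derivatives -/

section DirDeriv

variable {E : Type*} [NormedAddCommGroup E] [NormedSpace ℝ E]

/-- The derivative of `g` in the direction `v`. -/
noncomputable def dirDeriv (v : E) (g : E → ℝ) : E → ℝ := fun x => fderiv ℝ g x v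

theorem ContDiffOn.dirDeriv {U : Set E} (hU : IsOpen U) {g : E → ℝ} {k m : ℕ∞ω}
    (hg : ContDiffOn ℝ m g U) (hk : k + 1 ≤ m) (v : E) : ContDiffOn ℝ k (dirDeriv v g) U :=
  (hg.fderiv_of_isOpen hU hk).clm_apply contDiffOn_const

theorem Set.EqOn.dirDeriv {U : Set E} (hU : IsOpen U) {g₁ g₂ : E → ℝ} (h : Set.EqOn g₁ g₂ U)
    (v : E) : Set.EqOn (dirDeriv v g₁) (dirDeriv v g₂) U := fun x hx => by
  have : g₁ =ᶠ[𝓝 x] g₂ := h.eventuallyEq_of_mem (hU.mem_nhds hx)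
  simp only [_root_.dirDeriv, this.fderiv_eq]

theorem dirDeriv_dirDeriv_apply {U : Set E} (hU : IsOpen U) {g : E → ℝ} (hg : ContDiffOn ℝ 2 g U)
    {x : E} (hx : x ∈ U) (v w : E) :
    dirDeriv v (dirDeriv w g) x = fderiv ℝ (fderiv ℝ g) x v w := by
  have h1 : ContDiffOn ℝ 1 (fderiv ℝ g) U := hg.fderiv_of_isOpen hU (by norm_num)
  have h2 : DifferentiableAt ℝ (fderiv ℝ g) x :=
    (h1.contDiffAt (hU.mem_nhds hx)).differentiableAt (by norm_num)
  change fderiv ℝ (fun y => fderiv ℝ g y w) x v = _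
  rw [fderiv_clm_apply h2 (differentiableAt_const w)]
  simp

theorem dirDeriv_comm {U : Set E} (hU : IsOpen U) {g : E → ℝ} (hg : ContDiffOn ℝ 2 g U) (v w : E) :
    Set.EqOn (dirDeriv v (dirDeriv w g)) (dirDeriv w (dirDeriv v g)) U := fun x hx => by
  rw [dirDeriv_dirDeriv_apply hU hg hx, dirDeriv_dirDeriv_apply hU hg hx]
  exact ((hg.contDiffAt (hU.mem_nhds hx)).isSymmSndFDerivAt (by simp)).eq v w

/-- Two swaps of adjacent derivatives. This matches the third derivatives arising from `|∇u|² / 2`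
and `log u_oo` with those of the differentiated equation. -/
theorem dirDeriv_three_comm {U : Set E} (hU : IsOpen U) {g : E → ℝ} (hg : ContDiffOn ℝ 3 g U)
    (v w z : E) :
    Set.EqOn (dirDeriv v (dirDeriv w (dirDeriv z g))) (dirDeriv z (dirDeriv v (dirDeriv w g))) U :=
  ((dirDeriv_comm hU (hg.of_le (by norm_num)) w z).dirDeriv hU v).trans
    (dirDeriv_comm hU (hg.dirDeriv hU (by norm_num) w) v z)

theorem dirDeriv_four_comm {U : Set E} (hU : IsOpen U) {g : E → ℝ} (hg : ContDiffOn ℝ 4 g U)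
    (v w : E) :
    Set.EqOn (dirDeriv v (dirDeriv v (dirDeriv w (dirDeriv w g))))
      (dirDeriv w (dirDeriv w (dirDeriv v (dirDeriv v g)))) U :=
  ((dirDeriv_three_comm hU (hg.of_le (by norm_num)) v w w).dirDeriv hU v).trans <|
    ((dirDeriv_comm hU ((hg.dirDeriv hU (k := 3) (by norm_num) w).dirDeriv hU (by norm_num) v)
      v w)).trans
    ((dirDeriv_three_comm hU (hg.of_le (by norm_num)) v v w).dirDeriv hU w)

theorem hasDerivAt_line {U : Set E} (hU : IsOpen U) {g : E → ℝ} (hg : ContDiffOn ℝ 1 g U)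
    {x v : E} {t : ℝ} (ht : x + t • v ∈ U) :
    HasDerivAt (fun s : ℝ => g (x + s • v)) (dirDeriv v g (x + t • v)) t := by
  have h1 : HasFDerivAt g (fderiv ℝ g (x + t • v)) (x + t • v) :=
    ((hg.contDiffAt (hU.mem_nhds ht)).differentiableAt (by norm_num)).hasFDerivAt
  have h2 : HasDerivAt (fun s : ℝ => x + s • v) v t := by
    simpa using ((hasDerivAt_id t).smul_const v).const_add x
  exact h1.comp_hasDerivAt t h2

theorem eventually_line_mem {U : Set E} (hU : IsOpen U) {x : E} (hx : x ∈ U) (v : E) :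
    ∀ᶠ t : ℝ in 𝓝 0, x + t • v ∈ U := by
  have hc : ContinuousAt (fun t : ℝ => x + t • v) 0 := by fun_prop
  exact hc.eventually_mem (by simpa using hU.mem_nhds hx)

theorem eventually_hasDerivAt_line {U : Set E} (hU : IsOpen U) {g : E → ℝ}
    (hg : ContDiffOn ℝ 1 g U) {x : E} (hx : x ∈ U) (v : E) :
    ∀ᶠ t : ℝ in 𝓝 0, HasDerivAt (fun s : ℝ => g (x + s • v)) (dirDeriv v g (x + t • v)) t :=
  (eventually_line_mem hU hx v).mono fun _ ht => hasDerivAt_line hU hg ht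

theorem hasDerivAt_line_zero {U : Set E} (hU : IsOpen U) {g : E → ℝ}
    (hg : ContDiffOn ℝ 1 g U) {x : E} (hx : x ∈ U) (v : E) :
    HasDerivAt (fun s : ℝ => g (x + s • v)) (dirDeriv v g x) 0 := by
  simpa using (eventually_hasDerivAt_line hU hg hx v).self_of_nhds

end DirDeriv

/-! ### Algebra of the maximum principle -/

section Algebra

theorem abs_sum_mul_le {ι : Type*} [Fintype ι] {s : Finset ι} {x y : ι → ℝ} {X Y : ℝ} (hX : 0 ≤ X) (hY : 0 ≤ Y)
    (hx : ∑ i, x i ^ 2 ≤ X ^ 2) (hy : ∑ i, y i ^ 2 ≤ Y ^ 2) : |∑ i ∈ s, x i * y i| ≤ X * Y := by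
  refine abs_le_of_sq_le_sq ?_ (by positivity)
  have h1 : ∑ i ∈ s, x i ^ 2 ≤ X ^ 2 :=
    (Finset.sum_le_univ_sum_of_nonneg fun i => sq_nonneg _).trans hx
  have h2 : ∑ i ∈ s, y i ^ 2 ≤ Y ^ 2 :=
    (Finset.sum_le_univ_sum_of_nonneg fun i => sq_nonneg _).trans hy
  calc _ ≤ (∑ i ∈ s, x i ^ 2) * ∑ i ∈ s, y i ^ 2 := Finset.sum_mul_sq_le_sq_mul_sq _ _ _
    _ ≤ X ^ 2 * Y ^ 2 := mul_le_mul h1 h2 (Finset.sum_nonneg fun i _ => sq_nonneg _) (by positivity)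
    _ = _ := by ring

variable {ι : Type*} [Fintype ι] [DecidableEq ι]

/-- Only row `o` and column `o` of the nonnegative array are kept, their common entry being counted
once. The factor 2 provides the surplus of third derivatives in the Pogorelov argument. -/
theorem two_mul_sum_sub_le_sum_sum {a : ι → ι → ℝ} (ha : ∀ i j, 0 ≤ a i j)
    (hs : ∀ i j, a i j = a j i) (o : ι) :
    2 * ∑ i, a o i - a o o ≤ ∑ i, ∑ j, a i j := by
  have h : ∀ i j, (if i = o then a o j else 0) + (if j = o then a o i else 0)
      - (if i = o then if j = o then a o o else 0 else 0) ≤ a i j := by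
    intro i j
    have h1 := ha i j
    have h2 := hs i j
    split_ifs with h3 h4 h4 <;> subst_vars <;> linarith
  refine le_trans (le_of_eq ?_) (Finset.sum_le_sum fun i _ => Finset.sum_le_sum fun j _ => h i j)
  simp only [Finset.sum_add_distrib, Finset.sum_sub_distrib, Finset.sum_ite_eq', Finset.mem_univ,
    if_true]
  rw [Finset.sum_comm]
  simp only [Finset.sum_ite_eq', Finset.mem_univ, if_true]
  have : ∀ i, (∑ j, if i = o then if j = o then a o o else 0 else 0) = if i = o then a o o else 0 := by
    intro i; split_ifs <;> simp
  simp only [this, Finset.sum_ite_eq', Finset.mem_univ, if_true]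
  ring

/-- The algebraic core of the maximum principle argument: `lam` are the eigenvalues of the Hessian,
`p` the gradient of the solution, `m` the gradient of the cut-off `l`, and `T`, `Q`, `R` collect
third and fourth derivatives. -/
theorem pogorelov_algebra {lam m p Q hk : ι → ℝ} {R T : ι → ι → ℝ} {l h₂ A B M : ℝ} {o : ι}
    (hlam : ∀ i, 0 < lam i) (hl : 0 < l) (hA0 : 0 ≤ A) (hM0 : 0 ≤ M)
    (hm : ∑ i, m i ^ 2 ≤ 1) (hp : ∑ i, p i ^ 2 ≤ M ^ 2) (hhk : ∑ i, hk i ^ 2 ≤ A ^ 2)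
    (hB : -B ≤ h₂) (hT : ∀ i j, T i j = T j i)
    (first : ∀ i, m i / l + T o i / lam o + p i * lam i = 0)
    (second : ∀ i, -(m i / l) ^ 2 + (Q i / lam o - (T o i / lam o) ^ 2)
      + (lam i ^ 2 + ∑ k, p k * R i k) ≤ 0)
    (eq₁ : ∀ k, ∑ i, R i k / lam i = hk k)
    (eq₂ : ∑ i, Q i / lam i - ∑ i, ∑ j, T i j * T j i / (lam i * lam j) = h₂) :
    (l * lam o) ^ 2 ≤ 1 + l ^ 2 * B + (2 * M + M * A * l) * (l * lam o) := by
  have hlo := hlam o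
  -- sum of the second order conditions
  have s1 : ∑ i, (-(m i / l) ^ 2 / lam i - (T o i / lam o) ^ 2 / lam i + lam i)
      + (∑ i, Q i / lam i) / lam o + ∑ k, p k * hk k ≤ 0 := by
    have e : ∑ k, p k * hk k = ∑ i, (∑ k, p k * R i k) / lam i := by
      simp only [← eq₁, Finset.mul_sum, Finset.sum_div]
      rw [Finset.sum_comm]
      exact Finset.sum_congr rfl fun i _ => Finset.sum_congr rfl fun k _ => by ring
    rw [e, Finset.sum_div, ← Finset.sum_add_distrib, ← Finset.sum_add_distrib]
    refine Finset.sum_nonpos fun i _ => ?_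
    have := hlam i
    have h3 := div_nonpos_of_nonpos_of_nonneg (second i) this.le
    refine le_trans (le_of_eq ?_) h3
    field_simp
    ring
  -- The concavity term of `log det` dominates twice the squared third derivatives that `log u_oo`
  -- contributes with a minus sign.
  have s2 : 2 * ∑ i, (T o i / lam o) ^ 2 / lam i - (T o o / lam o) ^ 2 / lam o
      ≤ (∑ i, ∑ j, T i j * T j i / (lam i * lam j)) / lam o := by
    have h1 := two_mul_sum_sub_le_sum_sum (a := fun i j => T i j * T j i / (lam i * lam j))
      (fun i j => by
        rw [hT j i]
        exact div_nonneg (mul_self_nonneg _) (mul_pos (hlam i) (hlam j)).le)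
      (fun i j => by rw [mul_comm (T i j), mul_comm (lam i)]) o
    rw [le_div_iff₀ hlo]
    refine le_trans (le_of_eq ?_) h1
    rw [sub_mul, mul_assoc, Finset.sum_mul]
    congr 1
    · congr 1
      refine Finset.sum_congr rfl fun i _ => ?_
      have := hlam i
      rw [hT i o]
      field_simp
    · field_simp
  -- The first order condition trades third derivatives for `m`, `p` and `lam`.
  have s3 : ∀ i, (T o i / lam o) ^ 2 / lam i
      = (m i / l) ^ 2 / lam i + 2 * (m i * p i) / l + p i ^ 2 * lam i := by
    intro i
    have h1 : T o i / lam o = -(m i / l + p i * lam i) := by linarith [first i]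
    have := hlam i
    rw [h1]
    field_simp
    ring
  -- The surplus copy cancels `(m i / l) ^ 2 / lam i`, which has no bound when `lam i` is small.
  have s4 : ∑ i, (-(m i / l) ^ 2 / lam i - (T o i / lam o) ^ 2 / lam i + lam i)
      + 2 * ∑ i, (T o i / lam o) ^ 2 / lam i
      = 2 / l * ∑ i, m i * p i + ∑ i, p i ^ 2 * lam i + ∑ i, lam i := by
    rw [Finset.mul_sum, Finset.mul_sum, ← Finset.sum_add_distrib, ← Finset.sum_add_distrib,
      ← Finset.sum_add_distrib]
    refine Finset.sum_congr rfl fun i _ => ?_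
    rw [s3 i]
    ring
  have s5 : p o ^ 2 * lam o ≤ ∑ i, p i ^ 2 * lam i :=
    Finset.single_le_sum (f := fun i => p i ^ 2 * lam i)
      (fun i _ => mul_nonneg (sq_nonneg _) (hlam i).le) (Finset.mem_univ o)
  have s6 : lam o ≤ ∑ i, lam i :=
    Finset.single_le_sum (fun i _ => (hlam i).le) (Finset.mem_univ o)
  have s7 : m o ^ 2 ≤ 1 :=
    (Finset.single_le_sum (f := fun i => m i ^ 2) (fun i _ => sq_nonneg _)
      (Finset.mem_univ o)).trans hm
  have s8 : |∑ i ∈ Finset.univ.erase o, m i * p i| ≤ 1 * M :=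
    abs_sum_mul_le zero_le_one hM0 (by simpa using hm) hp
  have s9 : |∑ k, p k * hk k| ≤ M * A := abs_sum_mul_le hM0 hA0 hp hhk
  have s10 : ∑ i, m i * p i = m o * p o + ∑ i ∈ Finset.univ.erase o, m i * p i :=
    (Finset.add_sum_erase _ _ (Finset.mem_univ o)).symm
  have s11 : (∑ i, Q i / lam i) / lam o
      = h₂ / lam o + (∑ i, ∑ j, T i j * T j i / (lam i * lam j)) / lam o := by
    rw [← eq₂]; ring
  have s12 := s3 o
  -- Subtracting the once-counted entry `o` restores the cut-off term there, harmlessly divided by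
  -- the largest eigenvalue in the application; `s5` absorbs `p o ^ 2 * lam o`.
  have key : 2 / l * ∑ i ∈ Finset.univ.erase o, m i * p i + lam o - (m o / l) ^ 2 / lam o
      + h₂ / lam o + ∑ k, p k * hk k ≤ 0 := by
    have : 2 / l * (m o * p o) = 2 * (m o * p o) / l := by ring
    rw [s10, mul_add] at s4
    linarith
  have k1 := (abs_le.1 s8).1
  have k2 := (abs_le.1 s9).1
  set X := ∑ i ∈ Finset.univ.erase o, m i * p i
  set Y := ∑ k, p k * hk k
  -- Multiplying by `l ^ 2 * lam o` clears denominators and yields a quadratic inequality for `l *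
  -- lam o`.
  have key2 : 2 * l * lam o * X + (l * lam o) ^ 2 - m o ^ 2 + l ^ 2 * h₂ + l ^ 2 * lam o * Y ≤ 0 := by
    have := mul_nonpos_of_nonneg_of_nonpos (mul_pos (pow_pos hl 2) hlo).le key
    refine le_trans (le_of_eq ?_) this
    field_simp
  have k3 : 2 * l * lam o * (-(1 * M)) ≤ 2 * l * lam o * X :=
    mul_le_mul_of_nonneg_left k1 (by positivity)
  have k4 : l ^ 2 * lam o * (-(M * A)) ≤ l ^ 2 * lam o * Y :=
    mul_le_mul_of_nonneg_left k2 (by positivity)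
  have k5 : l ^ 2 * (-B) ≤ l ^ 2 * h₂ := mul_le_mul_of_nonneg_left hB (by positivity)
  linarith

end Algebra

/-! ### The estimate at an interior maximum -/

section Interior

variable {E : Type*} [NormedAddCommGroup E] [InnerProductSpace ℝ E] [FiniteDimensional ℝ E]
  {ι : Type*} [Fintype ι]

theorem OrthonormalBasis.sum_sq_apply_eq_norm_sq (b : OrthonormalBasis ι ℝ E) (L : E →L[ℝ] ℝ) :
    ∑ i, L (b i) ^ 2 = ‖L‖ ^ 2 := by
  have h := b.sum_sq_norm_inner_left ((InnerProductSpace.toDual ℝ E).symm L)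
  simpa using h

variable [DecidableEq ι]

/-- The interior estimate at a maximum point of the auxiliary function, in a basis diagonalising
the Hessian at that point. -/
theorem sq_le_of_isLocalMax {U : Set E} (hU : IsOpen U) {u h : E → ℝ} (hu : ContDiffOn ℝ 4 u U)
    (hh : ContDiffOn ℝ 2 h U) (b : OrthonormalBasis ι ℝ E) {x : E} (hx : x ∈ U) {lam : ι → ℝ}
    (hlam : ∀ i, 0 < lam i)
    (hdiag : ∀ i j, dirDeriv (b i) (dirDeriv (b j) u) x = if i = j then lam i else 0)
    (hdet : ∀ y ∈ U,
      Real.log (Matrix.of fun i j => dirDeriv (b i) (dirDeriv (b j) u) y).det = h y)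
    {e : E} {c : ℝ} (he : ‖e‖ = 1) (hl : 0 < inner ℝ e x - c) (o : ι)
    (hmax : IsLocalMax (fun y => Real.log (inner ℝ e y - c)
      + Real.log (dirDeriv (b o) (dirDeriv (b o) u) y) + (∑ k, dirDeriv (b k) u y ^ 2) / 2) x)
    {A B M : ℝ} (hA : ‖fderiv ℝ h x‖ ≤ A) (hB : -B ≤ dirDeriv (b o) (dirDeriv (b o) h) x)
    (hM : ‖fderiv ℝ u x‖ ≤ M) :
    ((inner ℝ e x - c) * lam o) ^ 2 ≤ 1 + (inner ℝ e x - c) ^ 2 * B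
      + (2 * M + M * A * (inner ℝ e x - c)) * ((inner ℝ e x - c) * lam o) := by
  have hu1 : ∀ i, ContDiffOn ℝ 3 (dirDeriv (b i) u) U := fun i => hu.dirDeriv hU (by norm_num) _
  have hu2 : ∀ i j, ContDiffOn ℝ 2 (dirDeriv (b i) (dirDeriv (b j) u)) U :=
    fun i j => (hu1 j).dirDeriv hU (by norm_num) _
  have hu3 : ∀ i j k, ContDiffOn ℝ 1 (dirDeriv (b i) (dirDeriv (b j) (dirDeriv (b k) u))) U :=
    fun i j k => (hu2 j k).dirDeriv hU (by norm_num) _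
  have hh1 : ∀ i, ContDiffOn ℝ 1 (dirDeriv (b i) h) U := fun i => hh.dirDeriv hU (by norm_num) _
  have hu3' : ContDiffOn ℝ 3 u U := hu.of_le (by norm_num)
  -- Maximum conditions along the line through `x` in direction `b i`; diagonality leaves a single
  -- `lam i` from the derivative of the gradient.
  have cond : ∀ i,
      inner ℝ e (b i) / (inner ℝ e x - c)
        + dirDeriv (b i) (dirDeriv (b o) (dirDeriv (b o) u)) x / lam o
        + dirDeriv (b i) u x * lam i = 0 ∧
      -(inner ℝ e (b i) / (inner ℝ e x - c)) ^ 2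
        + (dirDeriv (b i) (dirDeriv (b i) (dirDeriv (b o) (dirDeriv (b o) u))) x / lam o
          - (dirDeriv (b i) (dirDeriv (b o) (dirDeriv (b o) u)) x / lam o) ^ 2)
        + (lam i ^ 2 + ∑ k, dirDeriv (b k) u x *
            dirDeriv (b i) (dirDeriv (b i) (dirDeriv (b k) u)) x) ≤ 0 := by
    intro i
    have hline : Tendsto (fun t : ℝ => x + t • b i) (𝓝 0) (𝓝 x) := by
      have : ContinuousAt (fun t : ℝ => x + t • b i) 0 := by fun_prop
      simpa [ContinuousAt] using this
    have hmax' : IsLocalMax ((fun y => Real.log (inner ℝ e y - c)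
      + Real.log (dirDeriv (b o) (dirDeriv (b o) u) y) + (∑ k, dirDeriv (b k) u y ^ 2) / 2) ∘
        fun t : ℝ => x + t • b i) 0 := by
      have := hline.eventually hmax
      simpa [IsLocalMax, IsMaxFilter] using this
    have key := IsLocalMax.log_add_log_add_sum_sq (a := 0)
      (L := fun t : ℝ => inner ℝ e (x + t • b i) - c) (m := inner ℝ e (b i))
      (W := fun t : ℝ => dirDeriv (b o) (dirDeriv (b o) u) (x + t • b i))
      (W' := fun t : ℝ => dirDeriv (b i) (dirDeriv (b o) (dirDeriv (b o) u)) (x + t • b i))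
      (P := fun k (t : ℝ) => dirDeriv (b k) u (x + t • b i))
      (P' := fun k (t : ℝ) => dirDeriv (b i) (dirDeriv (b k) u) (x + t • b i))
      (fun t => by
        have h2 : HasDerivAt (fun s : ℝ => inner ℝ e x + s * inner ℝ e (b i) - c)
            (inner ℝ e (b i)) t := by
          simpa using (((hasDerivAt_id t).mul_const (inner ℝ e (b i))).const_add
            (inner ℝ e x)).sub_const c
        simpa only [inner_add_right, real_inner_smul_right] using h2)
      (by simpa using hl)
      (eventually_hasDerivAt_line hU ((hu2 o o).of_le (by norm_num)) hx _)
      (by simpa [hdiag] using hlam o)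
      (hasDerivAt_line_zero hU (hu3 i o o) hx _)
      (fun k => eventually_hasDerivAt_line hU ((hu1 k).of_le (by norm_num)) hx _)
      (fun k => hasDerivAt_line_zero hU ((hu2 i k).of_le (by norm_num)) hx _)
      hmax'
    simpa [hdiag, Finset.sum_add_distrib, ite_pow] using key
  -- The equation differentiated once and twice in direction `b k`.
  have logdet : ∀ k,
      ∑ i, dirDeriv (b k) (dirDeriv (b i) (dirDeriv (b i) u)) x / lam i = dirDeriv (b k) h x ∧
      ∑ i, dirDeriv (b k) (dirDeriv (b k) (dirDeriv (b i) (dirDeriv (b i) u))) x / lam i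
        - ∑ i, ∑ j, dirDeriv (b k) (dirDeriv (b i) (dirDeriv (b j) u)) x
          * dirDeriv (b k) (dirDeriv (b j) (dirDeriv (b i) u)) x / (lam i * lam j)
        = dirDeriv (b k) (dirDeriv (b k) h) x := by
    intro k
    have key := Matrix.log_det_deriv_two (a := 0) (lam := lam)
      (M := fun t : ℝ => Matrix.of fun i j => dirDeriv (b i) (dirDeriv (b j) u) (x + t • b k))
      (M' := fun t : ℝ => Matrix.of fun i j =>
        dirDeriv (b k) (dirDeriv (b i) (dirDeriv (b j) u)) (x + t • b k))
      (M'' := Matrix.of fun i j =>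
        dirDeriv (b k) (dirDeriv (b k) (dirDeriv (b i) (dirDeriv (b j) u))) x)
      (H := fun t : ℝ => h (x + t • b k)) (H' := fun t : ℝ => dirDeriv (b k) h (x + t • b k))
      (fun i j => eventually_hasDerivAt_line hU ((hu2 i j).of_le (by norm_num)) hx _)
      (fun i j => hasDerivAt_line_zero hU (hu3 k i j) hx _)
      (by ext i j; simp [hdiag, Matrix.diagonal_apply]) hlam
      ((eventually_line_mem hU hx _).mono fun t ht => hdet _ ht)
      (eventually_hasDerivAt_line hU (hh.of_le (by norm_num)) hx _)
      (hasDerivAt_line_zero hU (hh1 k) hx _)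
    simpa using key
  refine pogorelov_algebra (lam := lam) (m := fun i => inner ℝ e (b i))
    (p := fun i => dirDeriv (b i) u x) (hk := fun i => dirDeriv (b i) h x)
    (Q := fun i => dirDeriv (b i) (dirDeriv (b i) (dirDeriv (b o) (dirDeriv (b o) u))) x)
    (R := fun i k => dirDeriv (b i) (dirDeriv (b i) (dirDeriv (b k) u)) x)
    (T := fun i j => dirDeriv (b o) (dirDeriv (b i) (dirDeriv (b j) u)) x)
    hlam hl ((norm_nonneg _).trans hA) ((norm_nonneg _).trans hM) ?_ ?_ ?_ hB ?_ ?_ ?_ ?_ ?_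
  · have := b.sum_sq_norm_inner_left e
    simp only [Real.norm_eq_abs, sq_abs] at this
    rw [this, he]; norm_num
  · refine (b.sum_sq_apply_eq_norm_sq (fderiv ℝ u x)).trans_le ?_
    gcongr
  · refine (b.sum_sq_apply_eq_norm_sq (fderiv ℝ h x)).trans_le ?_
    gcongr
  · exact fun i j => (dirDeriv_comm hU (hu.of_le (by norm_num)) (b i) (b j)).dirDeriv hU (b o) hx
  · intro i
    simp only [dirDeriv_three_comm hU hu3' (b o) (b o) (b i) hx]
    exact (cond i).1
  · intro i
    simp only [dirDeriv_three_comm hU hu3' (b o) (b o) (b i) hx]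
    exact (cond i).2
  · intro k
    simp only [dirDeriv_three_comm hU hu3' _ _ (b k) hx]
    exact (logdet k).1
  · simp only [dirDeriv_four_comm hU hu _ (b o) hx]
    exact (logdet o).2

end Interior

/-! ### Quadratic forms and their norms -/

section Bilinear

variable {E : Type*} [NormedAddCommGroup E] [InnerProductSpace ℝ E]

/-- A positive semidefinite symmetric form bounded by `c` on the diagonal of the unit ball is
bounded by `c`. -/
theorem abs_apply_le_of_diag_le {B : E →L[ℝ] E →L[ℝ] ℝ} {c : ℝ} (hs : ∀ v w, B v w = B w v)
    (h0 : ∀ v, 0 ≤ B v v) (hc : ∀ v, ‖v‖ = 1 → B v v ≤ c) (v w : E) :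
    |B v w| ≤ c * ‖v‖ * ‖w‖ := by
  have hq : ∀ z, B z z ≤ c * ‖z‖ ^ 2 := by
    intro z
    rcases eq_or_ne z 0 with rfl | hz
    · simp
    have hz' : 0 < ‖z‖ := norm_pos_iff.2 hz
    have h1 := hc (‖z‖⁻¹ • z) (by rw [norm_smul, norm_inv, norm_norm, inv_mul_cancel₀ hz'.ne'])
    simp only [map_smul, smul_apply, smul_eq_mul] at h1
    have h2 : B z z = ‖z‖ ^ 2 * (‖z‖⁻¹ * (‖z‖⁻¹ * B z z)) := by field_simp
    rw [h2, mul_comm c]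
    exact mul_le_mul_of_nonneg_left h1 (by positivity)
  rcases eq_or_ne v 0 with rfl | hv
  · simp
  rcases eq_or_ne w 0 with rfl | hw
  · simp
  have hv' : 0 < ‖v‖ := norm_pos_iff.2 hv
  have hw' : 0 < ‖w‖ := norm_pos_iff.2 hw
  have hc0 : 0 ≤ c := by
    have := (h0 v).trans (hq v)
    exact nonneg_of_mul_nonneg_left this (by positivity)
  -- Polarisation with `‖w‖ • v ± ‖v‖ • w`: the scaling balances the two vectors, and
  -- semidefiniteness discards one of the two squares, giving the sharp constant.
  have e1 : ∀ s : ℝ, B (‖w‖ • v + (s * ‖v‖) • w) (‖w‖ • v + (s * ‖v‖) • w)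
      = ‖w‖ ^ 2 * B v v + 2 * s * (‖v‖ * ‖w‖ * B v w) + s ^ 2 * ‖v‖ ^ 2 * B w w := by
    intro s
    simp only [map_add, map_smul, add_apply, smul_apply,
      smul_eq_mul, hs w v]
    ring
  have e2 : ∀ s : ℝ, |s| = 1 → ‖‖w‖ • v + (s * ‖v‖) • w‖ ^ 2 ≤ (2 * (‖v‖ * ‖w‖)) ^ 2 := by
    intro s h
    gcongr
    refine (norm_add_le _ _).trans (le_of_eq ?_)
    rw [norm_smul, norm_smul, norm_mul, norm_norm, norm_norm, Real.norm_eq_abs, h]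
    ring
  have hp := e1 1
  have hm := e1 (-1)
  have hp1 := (hq _).trans (mul_le_mul_of_nonneg_left (e2 1 (by simp)) hc0)
  have hm1 := (hq _).trans (mul_le_mul_of_nonneg_left (e2 (-1) (by simp)) hc0)
  have hp0 := h0 (‖w‖ • v + (1 * ‖v‖) • w)
  have hm0 := h0 (‖w‖ • v + (-1 * ‖v‖) • w)
  have hvw : 0 < ‖v‖ * ‖w‖ := by positivity
  rw [abs_le]
  constructor
  · have : -(c * (‖v‖ * ‖w‖)) * (‖v‖ * ‖w‖) ≤ B v w * (‖v‖ * ‖w‖) := by nlinarith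
    have := le_of_mul_le_mul_right this hvw
    linarith
  · have : B v w * (‖v‖ * ‖w‖) ≤ (c * (‖v‖ * ‖w‖)) * (‖v‖ * ‖w‖) := by nlinarith
    have := le_of_mul_le_mul_right this hvw
    linarith

theorem apply_self_eq_sum_of_diagonal {ι : Type*} [Fintype ι] [DecidableEq ι]
    (b : OrthonormalBasis ι ℝ E) {B : E →L[ℝ] E →L[ℝ] ℝ} {lam : ι → ℝ}
    (h : ∀ i j, B (b i) (b j) = if i = j then lam i else 0) (v : E) :
    B v v = ∑ i, lam i * inner ℝ (b i) v ^ 2 := by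
  conv_lhs => rw [← b.sum_repr' v]
  simp only [map_sum, map_smul, sum_apply, smul_apply,
    smul_eq_mul, h]
  refine Finset.sum_congr rfl fun i _ => ?_
  simp
  ring

end Bilinear

/-! ### Orthonormal bases and the Hessian matrix -/

section Euclidean

variable {n : ℕ}

/-- The matrix of a bilinear form in the standard basis. -/
noncomputable def stdMatrix
    (B : EuclideanSpace ℝ (Fin n) →L[ℝ] EuclideanSpace ℝ (Fin n) →L[ℝ] ℝ) :
    Matrix (Fin n) (Fin n) ℝ :=
  Matrix.of fun i j => B (EuclideanSpace.single i 1) (EuclideanSpace.single j 1)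

theorem apply_eq_sum_stdMatrix
    (B : EuclideanSpace ℝ (Fin n) →L[ℝ] EuclideanSpace ℝ (Fin n) →L[ℝ] ℝ)
    (v w : EuclideanSpace ℝ (Fin n)) :
    B v w = ∑ i, ∑ j, v i * stdMatrix B i j * w j := by
  have hv : ∀ v : EuclideanSpace ℝ (Fin n), v = ∑ i, v i • EuclideanSpace.single i (1 : ℝ) := by
    intro v
    simpa using ((EuclideanSpace.basisFun (Fin n) ℝ).sum_repr v).symm
  conv_lhs => rw [hv v, hv w]
  simp only [map_sum, map_smul, sum_apply, smul_apply,
    smul_eq_mul, stdMatrix, Matrix.of_apply]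
  simp only [Finset.mul_sum]
  rw [Finset.sum_comm]
  exact Finset.sum_congr rfl fun i _ => Finset.sum_congr rfl fun j _ => by ring

/-- The change of basis is orthogonal, so its determinant squares to 1. Hence the Monge-Ampère
equation keeps its form in an eigenbasis of the Hessian. -/
theorem det_orthonormalBasis (B : EuclideanSpace ℝ (Fin n) →L[ℝ] EuclideanSpace ℝ (Fin n) →L[ℝ] ℝ)
    (b : OrthonormalBasis (Fin n) ℝ (EuclideanSpace ℝ (Fin n))) :
    (Matrix.of fun i j => B (b i) (b j)).det = (stdMatrix B).det := by
  let P : Matrix (Fin n) (Fin n) ℝ := Matrix.of fun k i => b i k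
  have h1 : (Matrix.of fun i j => B (b i) (b j)) = P.transpose * stdMatrix B * P := by
    ext i j
    rw [Matrix.of_apply, apply_eq_sum_stdMatrix]
    simp only [Matrix.mul_apply, Matrix.transpose_apply, P, Matrix.of_apply, Finset.sum_mul]
    rw [Finset.sum_comm]
  have h2 : P.transpose * P = 1 := by
    ext i j
    have := orthonormal_iff_ite.1 b.orthonormal i j
    simp only [Matrix.mul_apply, Matrix.transpose_apply, P, Matrix.of_apply, Matrix.one_apply]
    rw [← this, PiLp.inner_apply]
    simp [mul_comm]
  have h3 : P.det * P.det = 1 := by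
    have := congrArg Matrix.det h2
    rwa [Matrix.det_mul, Matrix.det_transpose, Matrix.det_one] at this
  rw [h1, Matrix.det_mul, Matrix.det_mul, Matrix.det_transpose]
  linear_combination (stdMatrix B).det * h3

/-- A symmetric bilinear form is diagonal in some orthonormal basis. -/
theorem exists_orthonormalBasis_diagonal
    {B : EuclideanSpace ℝ (Fin n) →L[ℝ] EuclideanSpace ℝ (Fin n) →L[ℝ] ℝ}
    (hs : ∀ v w, B v w = B w v) :
    ∃ (b : OrthonormalBasis (Fin n) ℝ (EuclideanSpace ℝ (Fin n))) (lam : Fin n → ℝ),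
      ∀ i j, B (b i) (b j) = if i = j then lam i else 0 := by
  have hA : (stdMatrix B).IsHermitian := by
    ext i j
    simp [stdMatrix, hs (EuclideanSpace.single i 1)]
  refine ⟨hA.eigenvectorBasis, hA.eigenvalues, fun i j => ?_⟩
  have h1 : ∀ k, ∑ l, stdMatrix B k l * hA.eigenvectorBasis j l
      = hA.eigenvalues j * hA.eigenvectorBasis j k := by
    intro k
    simpa [Matrix.mulVec, dotProduct] using congrFun (hA.mulVec_eigenvectorBasis j) k
  have h2 := orthonormal_iff_ite.1 hA.eigenvectorBasis.orthonormal i j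
  rw [PiLp.inner_apply] at h2
  rw [apply_eq_sum_stdMatrix]
  simp only [mul_assoc, ← Finset.mul_sum, h1]
  rw [← mul_one (hA.eigenvalues i), ← mul_zero (hA.eigenvalues j)]
  have h3 : (if i = j then hA.eigenvalues i * 1 else hA.eigenvalues j * 0)
      = hA.eigenvalues j * if i = j then 1 else 0 := by
    split_ifs with h
    · rw [h]
    · rfl
  rw [h3, ← h2, Finset.mul_sum]
  refine Finset.sum_congr rfl fun k _ => ?_
  simp
  ring

theorem hessianMatrix_eq_stdMatrix (u : EuclideanSpace ℝ (Fin n) → ℝ)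
    (x : EuclideanSpace ℝ (Fin n)) :
    hessianMatrix u x = stdMatrix (fderiv ℝ (fderiv ℝ u) x) := by
  ext i j
  simp [hessianMatrix, stdMatrix, iteratedFDeriv_two_apply]

end Euclidean

/-! ### Convexity and the second differential -/

section Convex

variable {E : Type*} [NormedAddCommGroup E] [NormedSpace ℝ E]

/-- On a short segment inside `V` the restriction of `u` is convex, so its derivative is monotone.
Only such segments matter, so `V` may be non-convex, like `Ω \ Γ`. -/
theorem ConvexOn.sndFDeriv_nonneg {s V : Set E} {u : E → ℝ} (hc : ConvexOn ℝ s u) (hV : IsOpen V)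
    (hVs : V ⊆ s) (hu : ContDiffOn ℝ 2 u V) {x : E} (hx : x ∈ V) (v : E) :
    0 ≤ fderiv ℝ (fderiv ℝ u) x v v := by
  obtain ⟨r, hr, hball⟩ := Metric.mem_nhds_iff.1 (eventually_line_mem hV hx v)
  rw [← dirDeriv_dirDeriv_apply hV hu hx]
  have hlin : ∀ t ∈ Metric.ball (0 : ℝ) r, x + t • v ∈ V := fun t ht => hball ht
  have hcv : ConvexOn ℝ (Metric.ball (0 : ℝ) r) fun t : ℝ => u (x + t • v) := by
    refine ⟨convex_ball _ _, fun a ha b hb p q hp hq hpq => ?_⟩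
    have := hc.2 (hVs (hlin a ha)) (hVs (hlin b hb)) hp hq hpq
    convert this using 2
    have h1 : x = p • x + q • x := by rw [← add_smul, hpq, one_smul]
    conv_lhs => rw [h1]
    simp only [smul_add, smul_smul, smul_eq_mul, add_smul]
    abel
  have hd : ∀ t ∈ Metric.ball (0 : ℝ) r,
      HasDerivAt (fun t : ℝ => u (x + t • v)) (dirDeriv v u (x + t • v)) t :=
    fun t ht => hasDerivAt_line hV (hu.of_le (by norm_num)) (hlin t ht)
  have hmono : MonotoneOn (fun t : ℝ => dirDeriv v u (x + t • v)) (Metric.ball (0 : ℝ) r) := by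
    refine (hcv.monotoneOn_deriv fun t ht => (hd t ht).differentiableAt).congr ?_
    exact fun t ht => (hd t ht).deriv
  have h2 := hasDerivAt_line_zero hV (hu.dirDeriv hV (k := 1) (by norm_num) v) hx v
  have h3 := hmono.derivWithin_nonneg (x := (0 : ℝ))
  rwa [derivWithin_of_mem_nhds (Metric.ball_mem_nhds _ hr), h2.deriv] at h3

end Convex

/-! ### The maximum principle on a cap -/

/-- If `s > a + b`, then `s ≥ 1` and `s ^ 2 > a * s + b * s ≥ a + b * s`. -/
theorem le_add_of_sq_le {s a b : ℝ} (ha : 1 ≤ a) (hb : 0 ≤ b) (h : s ^ 2 ≤ a + b * s) :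
    s ≤ a + b := by
  by_contra! hs
  nlinarith

/-- The Hessian estimate in a region cut off by a hyperplane, in terms of bounds on the boundary
part `K \ V` of that region. Here `F₁` and `F₂` are continuous extensions of the first and second
differential of `u` to `K`. -/
theorem mul_hess_le_of_halfSpace {n : ℕ} {K V : Set (EuclideanSpace ℝ (Fin n))}
    {u h : EuclideanSpace ℝ (Fin n) → ℝ}
    {F₁ : EuclideanSpace ℝ (Fin n) → EuclideanSpace ℝ (Fin n) →L[ℝ] ℝ}
    {F₂ : EuclideanSpace ℝ (Fin n) →
      EuclideanSpace ℝ (Fin n) →L[ℝ] EuclideanSpace ℝ (Fin n) →L[ℝ] ℝ}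
    {e : EuclideanSpace ℝ (Fin n)} {c d A B M H : ℝ}
    (hV : IsOpen V) (hu : ContDiffOn ℝ 4 u V) (hh : ContDiffOn ℝ 2 h V)
    (hdet : ∀ y ∈ V, Real.log (hessianMatrix u y).det = h y)
    (hdet0 : ∀ y ∈ V, 0 < (hessianMatrix u y).det)
    (hconv : ∀ y ∈ V, ∀ v, 0 ≤ fderiv ℝ (fderiv ℝ u) y v v)
    (he : ‖e‖ = 1) (hK : IsCompact K) (hKl : ∀ y ∈ K, 0 ≤ inner ℝ e y - c)
    (hKd : ∀ y ∈ K, inner ℝ e y - c ≤ d)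
    (hVK : ∀ y ∈ V, 0 < inner ℝ e y - c → y ∈ K)
    (hF₁ : ContinuousOn F₁ K) (hF₂ : ContinuousOn F₂ K)
    (hF₁V : ∀ y ∈ V, F₁ y = fderiv ℝ u y) (hF₂V : ∀ y ∈ V, F₂ y = fderiv ℝ (fderiv ℝ u) y)
    (hA0 : 0 ≤ A) (hB0 : 0 ≤ B) (hM0 : 0 ≤ M) (hH0 : 0 ≤ H)
    (hA : ∀ y ∈ V, ‖fderiv ℝ h y‖ ≤ A)
    (hB : ∀ y ∈ V, ∀ v, ‖v‖ = 1 → -B ≤ fderiv ℝ (fderiv ℝ h) y v v)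
    (hM : ∀ y ∈ K, ‖F₁ y‖ ≤ M) (hH : ∀ y ∈ K, y ∉ V → ∀ v, ‖v‖ = 1 → F₂ y v v ≤ H)
    {x v : EuclideanSpace ℝ (Fin n)} (hx : x ∈ K) (hv : ‖v‖ = 1) :
    (inner ℝ e x - c) * F₂ x v v ≤
      Real.exp (M ^ 2 / 2) * (1 + d ^ 2 * B + 2 * M + M * A * d + d * H) := by
  have hd0 : 0 ≤ d := (hKl x hx).trans (hKd x hx)
  set C := 1 + d ^ 2 * B + 2 * M + M * A * d + d * H with hC
  have hC0 : 0 < C := by positivity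
  have hexp : ∀ y ∈ K, Real.exp (‖F₁ y‖ ^ 2 / 2) ≤ Real.exp (M ^ 2 / 2) := by
    intro y hy
    have := hM y hy
    gcongr
  -- The exponential supplies the coercive term `∑ lam i` in the summed second order conditions.
  -- Maximising over directions as well makes the top eigendirection admissible.
  let G : EuclideanSpace ℝ (Fin n) × EuclideanSpace ℝ (Fin n) → ℝ := fun z =>
    (inner ℝ e z.1 - c) * F₂ z.1 z.2 z.2 * Real.exp (‖F₁ z.1‖ ^ 2 / 2)
  have hGc : ContinuousOn G (K ×ˢ Metric.sphere 0 1) := by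
    have c1 : ContinuousOn (fun z : EuclideanSpace ℝ (Fin n) × EuclideanSpace ℝ (Fin n) => F₁ z.1)
        (K ×ˢ Metric.sphere 0 1) := hF₁.comp continuousOn_fst fun z hz => hz.1
    have c2 : ContinuousOn (fun z : EuclideanSpace ℝ (Fin n) × EuclideanSpace ℝ (Fin n) => F₂ z.1)
        (K ×ˢ Metric.sphere 0 1) := hF₂.comp continuousOn_fst fun z hz => hz.1
    have c3 := (c2.clm_apply continuousOn_snd).clm_apply continuousOn_snd
    have c4 : ContinuousOn (fun z : EuclideanSpace ℝ (Fin n) × EuclideanSpace ℝ (Fin n) =>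
        (inner ℝ e z.1 - c : ℝ)) (K ×ˢ Metric.sphere 0 1) := by fun_prop
    exact (c4.mul c3).mul (((c1.norm.pow 2).div_const 2).rexp)
  obtain ⟨⟨x₀, ξ⟩, ⟨hx₀, hξ⟩, hmax⟩ := (hK.prod (isCompact_sphere 0 1)).exists_isMaxOn
    ⟨(x, v), hx, by simpa using hv⟩ hGc
  have hmax' : ∀ y ∈ K, ∀ w, ‖w‖ = 1 → G (y, w) ≤ G (x₀, ξ) :=
    fun y hy w hw => hmax ⟨hy, by simpa using hw⟩
  simp only [mem_sphere_iff_norm, sub_zero] at hξ hx₀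
  -- it suffices to bound the maximum
  suffices hG : G (x₀, ξ) ≤ Real.exp (M ^ 2 / 2) * C by
    rcases le_or_gt ((inner ℝ e x - c) * F₂ x v v) 0 with h0 | h0
    · exact h0.trans (by positivity)
    · refine le_trans ?_ ((hmax' x hx v hv).trans hG)
      exact le_mul_of_one_le_right h0.le (Real.one_le_exp (by positivity))
  rcases le_or_gt (G (x₀, ξ)) 0 with h0 | h0
  · exact h0.trans (by positivity)
  have hl0 := hKl x₀ hx₀
  have hld := hKd x₀ hx₀
  have hpos : 0 < (inner ℝ e x₀ - c) * F₂ x₀ ξ ξ := pos_of_mul_pos_left h0 (Real.exp_pos _).le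
  have hl : 0 < inner ℝ e x₀ - c := by
    rcases hl0.eq_or_lt with h1 | h1
    · rw [← h1, zero_mul] at hpos; exact absurd hpos (lt_irrefl _)
    · exact h1
  have hF0 : 0 < F₂ x₀ ξ ξ := pos_of_mul_pos_right hpos hl0
  -- a bound for the product without the exponential factor is enough
  have fin : ∀ s, (inner ℝ e x₀ - c) * F₂ x₀ ξ ξ ≤ s → s ≤ C →
      G (x₀, ξ) ≤ Real.exp (M ^ 2 / 2) * C := by
    intro s h1 h2
    rw [mul_comm]
    exact mul_le_mul (h1.trans h2) (hexp x₀ hx₀) (Real.exp_pos _).le hC0.le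
  by_cases hxV : x₀ ∉ V
  · refine fin (d * H) (mul_le_mul hld (hH x₀ hx₀ hxV ξ hξ) hF0.le hd0) ?_
    rw [hC]
    have : 0 ≤ 1 + d ^ 2 * B + 2 * M + M * A * d := by positivity
    linarith
  push Not at hxV
  have hu2 : ContDiffOn ℝ 2 u V := hu.of_le (by norm_num)
  have hsymm : ∀ v w, fderiv ℝ (fderiv ℝ u) x₀ v w = fderiv ℝ (fderiv ℝ u) x₀ w v := fun v w =>
    ((hu2.contDiffAt (hV.mem_nhds hxV)).isSymmSndFDerivAt (by simp)).eq v w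
  obtain ⟨b, lam, hb⟩ := exists_orthonormalBasis_diagonal hsymm
  have hne : Nonempty (Fin n) := by
    by_contra hn
    rw [not_nonempty_iff] at hn
    have : ξ = 0 := Subsingleton.elim _ _
    simp [this] at hξ
  obtain ⟨o, ho⟩ := Finite.exists_max lam
  have hlam0 : ∀ i, 0 ≤ lam i := fun i => by
    have := hconv x₀ hxV (b i)
    rwa [hb, if_pos rfl] at this
  have hprod : 0 < ∏ i, lam i := by
    have h1 := hdet0 x₀ hxV
    rw [hessianMatrix_eq_stdMatrix, ← det_orthonormalBasis _ b] at h1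
    have h2 : (Matrix.of fun i j => fderiv ℝ (fderiv ℝ u) x₀ (b i) (b j)) = Matrix.diagonal lam := by
      ext i j
      simp [hb, Matrix.diagonal_apply]
    rwa [h2, Matrix.det_diagonal] at h1
  -- Convexity gives nonnegative eigenvalues, and the positive determinant excludes zero.
  have hlam : ∀ i, 0 < lam i := fun i => (hlam0 i).lt_of_ne' fun h1 =>
    hprod.ne' (Finset.prod_eq_zero (Finset.mem_univ i) h1)
  have htop : F₂ x₀ ξ ξ ≤ lam o := by
    rw [hF₂V x₀ hxV, apply_self_eq_sum_of_diagonal b hb]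
    calc ∑ i, lam i * inner ℝ (b i) ξ ^ 2 ≤ ∑ i, lam o * inner ℝ (b i) ξ ^ 2 :=
          Finset.sum_le_sum fun i _ => mul_le_mul_of_nonneg_right (ho i) (sq_nonneg _)
      _ = lam o := by
          have := b.sum_sq_norm_inner_right ξ
          simp only [Real.norm_eq_abs, sq_abs] at this
          rw [← Finset.mul_sum, this, hξ]
          ring
  have hdd : ∀ y ∈ V, ∀ i j, dirDeriv (b i) (dirDeriv (b j) u) y
      = fderiv ℝ (fderiv ℝ u) y (b i) (b j) :=
    fun y hy i j => dirDeriv_dirDeriv_apply hV hu2 hy _ _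
  have hww : dirDeriv (b o) (dirDeriv (b o) u) x₀ = lam o := by rw [hdd x₀ hxV, hb, if_pos rfl]
  have hlogG : ∀ y ∈ V, 0 < inner ℝ e y - c → 0 < dirDeriv (b o) (dirDeriv (b o) u) y →
      0 < G (y, b o) ∧ Real.log (G (y, b o)) = Real.log (inner ℝ e y - c)
        + Real.log (dirDeriv (b o) (dirDeriv (b o) u) y) + (∑ k, dirDeriv (b k) u y ^ 2) / 2 := by
    intro y hy h1 h2
    have h3 : G (y, b o) = (inner ℝ e y - c) * dirDeriv (b o) (dirDeriv (b o) u) y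
        * Real.exp (‖fderiv ℝ u y‖ ^ 2 / 2) := by
      simp only [G, hF₁V y hy, hF₂V y hy, hdd y hy]
    refine ⟨by rw [h3]; positivity, ?_⟩
    rw [h3, Real.log_mul (by positivity) (by positivity), Real.log_mul h1.ne' h2.ne',
      Real.log_exp, ← b.sum_sq_apply_eq_norm_sq]
    rfl
  -- The direction is frozen at `b o`: nearby `G (y, b o) ≤ G (x₀, ξ) ≤ G (x₀, b o)`, the last step
  -- by `htop`.
  have hloc : IsLocalMax (fun y => Real.log (inner ℝ e y - c)
      + Real.log (dirDeriv (b o) (dirDeriv (b o) u) y) + (∑ k, dirDeriv (b k) u y ^ 2) / 2) x₀ := by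
    have e1 : ∀ᶠ y in 𝓝 x₀, 0 < inner ℝ e y - c := by
      have : ContinuousAt (fun y => (inner ℝ e y - c : ℝ)) x₀ := by fun_prop
      exact this.eventually_const_lt hl
    have e2 : ∀ᶠ y in 𝓝 x₀, 0 < dirDeriv (b o) (dirDeriv (b o) u) y := by
      have h1 : ContDiffOn ℝ 0 (dirDeriv (b o) (dirDeriv (b o) u)) V :=
        (hu2.dirDeriv hV (k := 1) (by norm_num) _).dirDeriv hV (by norm_num) _
      exact (h1.continuousOn.continuousAt (hV.mem_nhds hxV)).eventually_const_lt
        (by rw [hww]; exact hlam o)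
    filter_upwards [e1, e2, hV.mem_nhds hxV] with y h1 h2 h3
    have g1 := hlogG y h3 h1 h2
    have g2 := hlogG x₀ hxV hl (by rw [hww]; exact hlam o)
    rw [← g1.2, ← g2.2]
    refine Real.log_le_log g1.1 ((hmax' y (hVK y h3 h1) _ (b.norm_eq_one o)).trans ?_)
    simp only [G]
    have : F₂ x₀ (b o) (b o) = lam o := by rw [hF₂V x₀ hxV, hb, if_pos rfl]
    rw [this]
    gcongr
  have hh0 := hB x₀ hxV (b o) (b.norm_eq_one o)
  rw [← dirDeriv_dirDeriv_apply hV hh hxV] at hh0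
  have key := sq_le_of_isLocalMax (M := M) hV hu hh b hxV hlam (fun i j => by rw [hdd x₀ hxV, hb])
    (fun y hy => by
      rw [← hdet y hy, hessianMatrix_eq_stdMatrix, ← det_orthonormalBasis _ b]
      simp only [hdd y hy])
    he hl o hloc (hA x₀ hxV) hh0 (by rw [← hF₁V x₀ hxV]; exact hM x₀ hx₀)
  refine fin ((inner ℝ e x₀ - c) * lam o) (mul_le_mul_of_nonneg_left htop hl0) ?_
  have hlo := hlam o
  have k2 : ((inner ℝ e x₀ - c) * lam o) ^ 2 ≤ (1 + d ^ 2 * B)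
      + (2 * M + M * A * d) * ((inner ℝ e x₀ - c) * lam o) := by
    refine key.trans ?_
    gcongr
  have k3 := le_add_of_sq_le (by have : 0 ≤ d ^ 2 * B := by positivity
                                 linarith) (by positivity) k2
  rw [hC]
  have : 0 ≤ d * H := by positivity
  linarith

/-! ### Essential suprema as pointwise bounds -/

section Norms

theorem eLpNorm_top_lt_top_of_bound {E F : Type*} [NormedAddCommGroup F] [MeasurableSpace E]
    {μ : Measure E} {s : Set E}
    (hs : MeasurableSet s) {g : E → F} {C : ℝ} (h : ∀ x ∈ s, ‖g x‖ ≤ C) :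
    eLpNorm g ⊤ (μ.restrict s) < ⊤ := by
  rw [eLpNorm_exponent_top]
  exact eLpNormEssSup_lt_top_of_ae_bound (C := C) (ae_restrict_of_forall_mem hs h)

variable {E F : Type*} [NormedAddCommGroup E] [NormedAddCommGroup F]

theorem norm_iteratedFDeriv_two {E : Type*} [NormedAddCommGroup E] [NormedSpace ℝ E] (g : E → ℝ)
    (x : E) :
    ‖iteratedFDeriv ℝ 2 g x‖ = ‖fderiv ℝ (fderiv ℝ g) x‖ := by
  rw [← norm_iteratedFDeriv_one, norm_iteratedFDeriv_fderiv]

theorem norm_gradient_eq {E : Type*} [NormedAddCommGroup E] [InnerProductSpace ℝ E]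
    [CompleteSpace E] (g : E → ℝ) (x : E) : ‖∇ g x‖ = ‖fderiv ℝ g x‖ := by
  simp [gradient]

/-- A function continuous on an open set is bounded there, pointwise, by its essential supremum. -/
theorem norm_le_toReal_eLpNorm_top [MeasurableSpace E] [BorelSpace E] {μ : Measure E}
    [μ.IsOpenPosMeasure] {s V : Set E} (hV : IsOpen V) (hVs : V ⊆ s) {g : E → F}
    (hg : ContinuousOn g V) (hfin : eLpNorm g ⊤ (μ.restrict s) ≠ ⊤) {x : E} (hx : x ∈ V) :
    ‖g x‖ ≤ (eLpNorm g ⊤ (μ.restrict s)).toReal := by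
  by_contra! hlt
  have hae : ∀ᵐ y ∂(μ.restrict V), ‖g y‖ ≤ (eLpNorm g ⊤ (μ.restrict s)).toReal := by
    refine ae_mono (Measure.restrict_mono_set μ hVs) ?_
    have : ∀ᵐ y ∂(μ.restrict s), ‖g y‖ₑ ≤ eLpNorm g ⊤ (μ.restrict s) := by
      rw [eLpNorm_exponent_top]
      exact ae_le_eLpNormEssSup
    filter_upwards [this] with y hy
    simpa using ENNReal.toReal_mono hfin hy
  rw [ae_restrict_iff' hV.measurableSet, ae_iff] at hae
  -- The set where the bound fails is open and null, hence empty.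
  obtain ⟨W, hWo, hW⟩ := (continuousOn_iff'.1 hg.norm)
    (Set.Ioi (eLpNorm g ⊤ (μ.restrict s)).toReal) isOpen_Ioi
  have hset : {y | ¬(y ∈ V → ‖g y‖ ≤ (eLpNorm g ⊤ (μ.restrict s)).toReal)} = W ∩ V := by
    rw [← hW]
    ext y
    simp [and_comm]
  rw [hset, (hWo.inter hV).measure_eq_zero_iff μ] at hae
  have : x ∈ W ∩ V := by
    rw [← hW]
    exact ⟨hlt, hx⟩
  rw [hae] at this
  exact this

end Norms

/-! ### Finiteness of the norms of the data -/

section Finiteness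

variable {E : Type*} [NormedAddCommGroup E] [NormedSpace ℝ E]

theorem exists_bound_fderiv_of_contDiffOn {Ω D : Set E} (hΩ : IsOpen Ω) (hΩD : Ω ⊆ D)
    (hD : IsCompact D) (hDu : UniqueDiffOn ℝ D) {g : E → ℝ} (hg : ContDiffOn ℝ 1 g D) :
    ∃ C, ∀ x ∈ Ω, ‖fderiv ℝ g x‖ ≤ C := by
  obtain ⟨C, hC⟩ := hD.exists_bound_of_continuousOn (hg.continuousOn_fderivWithin hDu (by norm_num))
  refine ⟨C, fun x hx => ?_⟩
  rw [← fderivWithin_of_mem_nhds (mem_of_superset (hΩ.mem_nhds hx) hΩD)]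
  exact hC x (hΩD hx)

/-- The second differential of the logarithm of a positive `C^{1,1}` function is bounded. -/
theorem exists_bound_sndFDeriv_log {Ω D : Set E} (hΩ : IsOpen Ω) (hΩc : Convex ℝ Ω) (hΩD : Ω ⊆ D)
    (hD : IsCompact D) (hDu : UniqueDiffOn ℝ D) {f : E → ℝ} (hf : ContDiffOn ℝ 1 f D)
    (hf0 : ∀ x ∈ D, 0 < f x) {K : ℝ≥0} (hK : LipschitzOnWith K (fderivWithin ℝ f D) D) :
    ∃ C, ∀ x ∈ Ω, ‖fderiv ℝ (fderiv ℝ fun y => Real.log (f y)) x‖ ≤ C := by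
  rcases Ω.eq_empty_or_nonempty with rfl | ⟨x₁, hx₁⟩
  · exact ⟨0, fun x hx => absurd hx (Set.notMem_empty x)⟩
  obtain ⟨z, hz, hzmin⟩ := hD.exists_isMinOn ⟨x₁, hΩD hx₁⟩ hf.continuousOn
  obtain ⟨C₁, hC₁⟩ := exists_bound_fderiv_of_contDiffOn hΩ hΩD hD hDu hf
  set δ := f z with hδ
  have hδ0 : 0 < δ := hf0 z hz
  have hle : ∀ x ∈ Ω, δ ≤ f x := fun x hx => hzmin (hΩD hx)
  have hC₁0 : 0 ≤ C₁ := (norm_nonneg _).trans (hC₁ x₁ hx₁)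
  have hnhds : ∀ x ∈ Ω, D ∈ 𝓝 x := fun x hx => mem_of_superset (hΩ.mem_nhds hx) hΩD
  have hdiff : ∀ x ∈ Ω, DifferentiableAt ℝ f x := fun x hx =>
    (hf.contDiffAt (hnhds x hx)).differentiableAt (by norm_num)
  have hlog : ∀ x ∈ Ω, fderiv ℝ (fun y => Real.log (f y)) x = (f x)⁻¹ • fderiv ℝ f x :=
    fun x hx => fderiv.log (hdiff x hx) (hδ0.trans_le (hle x hx)).ne'
  have hlip : ∀ x ∈ Ω, ∀ y ∈ Ω, ‖fderiv ℝ f y - fderiv ℝ f x‖ ≤ K * ‖y - x‖ := by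
    intro x hx y hy
    rw [← fderivWithin_of_mem_nhds (hnhds x hx), ← fderivWithin_of_mem_nhds (hnhds y hy)]
    simpa [dist_eq_norm] using hK.dist_le_mul y (hΩD hy) x (hΩD hx)
  -- A Lipschitz constant for `(1 / f) ∇f`, with `δ = min f`. It bounds the derivative even where
  -- that does not exist, since the default value is then 0.
  refine ⟨δ⁻¹ * K + (δ⁻¹ * δ⁻¹ * C₁) * C₁, fun x hx => ?_⟩
  refine norm_fderiv_le_of_lip' ℝ (by positivity) ?_
  filter_upwards [hΩ.mem_nhds hx] with y hy
  have hfx := hδ0.trans_le (hle x hx)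
  have hfy := hδ0.trans_le (hle y hy)
  have hsub : ‖f x - f y‖ ≤ C₁ * ‖y - x‖ := by
    rw [norm_sub_rev]
    exact hΩc.norm_image_sub_le_of_norm_fderiv_le hdiff hC₁ hx hy
  have ix : (f x)⁻¹ ≤ δ⁻¹ := inv_anti₀ hδ0 (hle x hx)
  have iy : (f y)⁻¹ ≤ δ⁻¹ := inv_anti₀ hδ0 (hle y hy)
  rw [hlog x hx, hlog y hy]
  have e : (f y)⁻¹ • fderiv ℝ f y - (f x)⁻¹ • fderiv ℝ f x
      = (f y)⁻¹ • (fderiv ℝ f y - fderiv ℝ f x)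
        + ((f y)⁻¹ * (f x)⁻¹ * (f x - f y)) • fderiv ℝ f x := by
    have : (f y)⁻¹ * (f x)⁻¹ * (f x - f y) = (f y)⁻¹ - (f x)⁻¹ := by field_simp
    rw [this, smul_sub, sub_smul]
    abel
  rw [e]
  refine (norm_add_le _ _).trans ?_
  rw [norm_smul, norm_smul, norm_mul, norm_mul, Real.norm_of_nonneg (inv_nonneg.2 hfy.le),
    Real.norm_of_nonneg (inv_nonneg.2 hfx.le), add_mul]
  refine add_le_add ?_ ?_
  · rw [mul_assoc]
    exact mul_le_mul iy (hlip x hx y hy) (norm_nonneg _) (by positivity)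
  · calc (f y)⁻¹ * (f x)⁻¹ * ‖f x - f y‖ * ‖fderiv ℝ f x‖
        ≤ δ⁻¹ * δ⁻¹ * (C₁ * ‖y - x‖) * C₁ := by
          have := hC₁ x hx
          gcongr
      _ = _ := by ring

/-- A convex function that is `C¹` up to the boundary away from a closed set in the interior has
bounded gradient. -/
theorem ConvexOn.exists_bound_fderiv [FiniteDimensional ℝ E] {Ω Γ : Set E} (hΩ : IsOpen Ω)
    (hΓ : IsClosed Γ) (hΓΩ : Γ ⊆ Ω) (hD : IsCompact (closure Ω))
    (hS : UniqueDiffOn ℝ (closure Ω \ Γ)) {u : E → ℝ} (hc : ConvexOn ℝ (closure Ω) u)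
    (hu : ContDiffOn ℝ 1 u (closure Ω \ Γ)) : ∃ C, ∀ x ∈ Ω, ‖fderiv ℝ u x‖ ≤ C := by
  suffices h : ∃ C, ∀ x ∈ closure Ω, x ∈ Ω → ‖fderiv ℝ u x‖ ≤ C by
    obtain ⟨C, hC⟩ := h
    exact ⟨C, fun x hx => hC x (subset_closure hx) hx⟩
  refine hD.induction_on (p := fun s => ∃ C, ∀ x ∈ s, x ∈ Ω → ‖fderiv ℝ u x‖ ≤ C) ?_ ?_ ?_ ?_
  · exact ⟨0, fun x hx => absurd hx (Set.notMem_empty x)⟩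
  · rintro s t hst ⟨C, hC⟩
    exact ⟨C, fun x hx => hC x (hst hx)⟩
  · rintro s t ⟨C, hC⟩ ⟨C', hC'⟩
    refine ⟨max C C', fun x hx hxΩ => ?_⟩
    rcases hx with hx | hx
    · exact (hC x hx hxΩ).trans (le_max_left _ _)
    · exact (hC' x hx hxΩ).trans (le_max_right _ _)
  · intro x hx
    by_cases hxΩ : x ∈ Ω
    · have hint : x ∈ interior (closure Ω) := interior_maximal subset_closure hΩ hxΩ
      -- Local Lipschitz continuity handles interior points, those of `Γ` included; only boundary
      -- points need `C¹` regularity.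
      obtain ⟨K, t, ht, hK⟩ := hc.locallyLipschitzOn_interior hint
      rw [isOpen_interior.nhdsWithin_eq hint] at ht
      refine ⟨interior t, mem_nhdsWithin_of_mem_nhds (interior_mem_nhds.2 ht), K, fun y hy _ => ?_⟩
      exact norm_fderiv_le_of_lipschitzOn ℝ (mem_interior_iff_mem_nhds.1 hy) hK
    · have hxΓ : x ∉ Γ := fun h => hxΩ (hΓΩ h)
      have hcont := (hu.continuousOn_fderivWithin hS (by norm_num) x ⟨hx, hxΓ⟩).norm
      have hev := hcont.eventually_lt_const (lt_add_one _)
      have hnh : 𝓝[closure Ω \ Γ] x = 𝓝[closure Ω] x :=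
        nhdsWithin_inter_of_mem' (mem_nhdsWithin_of_mem_nhds (hΓ.isOpen_compl.mem_nhds hxΓ))
      rw [hnh] at hev
      refine ⟨_, inter_mem hev (mem_nhdsWithin_of_mem_nhds (hΓ.isOpen_compl.mem_nhds hxΓ)),
        ‖fderivWithin ℝ u (closure Ω \ Γ) x‖ + 1, fun y hy hyΩ => ?_⟩
      have hmem : closure Ω \ Γ ∈ 𝓝 y := mem_of_superset
        ((hΩ.sdiff hΓ).mem_nhds ⟨hyΩ, hy.2⟩) (Set.sdiff_subset_sdiff_left subset_closure)
      rw [← fderivWithin_of_mem_nhds hmem]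
      exact le_of_lt hy.1

end Finiteness

/-! ### Regularity, separation and the explicit constant -/

theorem contDiffOn_det_hessianMatrix {n : ℕ} {V : Set (EuclideanSpace ℝ (Fin n))} (hV : IsOpen V)
    {u : EuclideanSpace ℝ (Fin n) → ℝ} (hu : ContDiffOn ℝ 4 u V) :
    ContDiffOn ℝ 2 (fun x => (hessianMatrix u x).det) V := by
  have h2 : ContDiffOn ℝ 2 (fderiv ℝ (fderiv ℝ u)) V :=
    (hu.fderiv_of_isOpen hV (m := 3) (by norm_num)).fderiv_of_isOpen hV (by norm_num)
  simp only [hessianMatrix_eq_stdMatrix, Matrix.det_apply']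
  refine ContDiffOn.sum fun σ _ => contDiffOn_const.mul (contDiffOn_prod fun i _ => ?_)
  exact (h2.clm_apply contDiffOn_const).clm_apply contDiffOn_const

/-- A point at positive distance from a closed convex set is separated from it by a hyperplane
orthogonal to the segment realising the distance. -/
theorem exists_unit_inner_le_of_convex {E : Type*} [NormedAddCommGroup E] [InnerProductSpace ℝ E]
    [ProperSpace E] {Γ : Set E} (hΓ : IsClosed Γ) (hne : Γ.Nonempty) (hc : Convex ℝ Γ) {x : E}
    (hx : x ∉ Γ) :
    ∃ p ∈ Γ, ∃ e : E, ‖e‖ = 1 ∧ inner ℝ e x - inner ℝ e p = Metric.infDist x Γ ∧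
      ∀ w ∈ Γ, inner ℝ e w ≤ inner ℝ e p := by
  obtain ⟨p, hp, hpd⟩ := hΓ.exists_infDist_eq_dist hne x
  have hd : Metric.infDist x Γ = ‖x - p‖ := by rw [hpd, dist_eq_norm]
  have hd0 : 0 < ‖x - p‖ := by
    rw [norm_pos_iff, sub_ne_zero]
    rintro rfl
    exact hx hp
  have hmin := (norm_eq_iInf_iff_real_inner_le_zero hc hp (u := x)).1 (by
    rw [← hd, Metric.infDist_eq_iInf]
    simp only [dist_eq_norm])
  refine ⟨p, hp, ‖x - p‖⁻¹ • (x - p), ?_, ?_, fun w hw => ?_⟩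
  · rw [norm_smul, norm_inv, norm_norm, inv_mul_cancel₀ hd0.ne']
  · rw [← inner_sub_right, real_inner_smul_left, real_inner_self_eq_norm_sq, hd]
    field_simp
  · rw [← sub_nonpos, ← inner_sub_right, real_inner_smul_left]
    exact mul_nonpos_of_nonneg_of_nonpos (by positivity) (hmin w hw)

/-- The bound in the Hessian estimate, as a function of the diameter and the norms of the data. -/
noncomputable def hessBound (t : ℝ × ℝ × ℝ × ℝ × ℝ) : ℝ :=
  Real.exp (max t.2.2.2.1 0 ^ 2 / 2) * (1 + max t.1 0 ^ 2 * max t.2.2.1 0 + 2 * max t.2.2.2.1 0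
    + max t.2.2.2.1 0 * max t.2.1 0 * max t.1 0 + max t.1 0 * max t.2.2.2.2 0)

/-- Clamping each argument at 0 makes the squares and products monotone on all of `ℝ⁵`; the actual
diameter and norms are nonnegative and unaffected. -/
theorem hessBound_monotone : Monotone hessBound := by
  rintro ⟨d, A, B, M, H⟩ ⟨d', A', B', M', H'⟩ ⟨h1, h2, h3, h4, h5⟩
  simp only at h1 h2 h3 h4 h5
  unfold hessBound
  simp only
  gcongr

theorem hessBound_pos (t : ℝ × ℝ × ℝ × ℝ × ℝ) : 0 < hessBound t := by
  unfold hessBound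
  positivity

/-! ### The estimate for the given data -/

section Data

variable {n : ℕ} {Ω Γ : Set (EuclideanSpace ℝ (Fin n))} {f u : EuclideanSpace ℝ (Fin n) → ℝ}

theorem uniqueDiffOn_closure_sdiff (hΩ : IsOpen Ω) (hΩc : Convex ℝ Ω) (hne : Ω.Nonempty)
    (hΓ : IsClosed Γ) : UniqueDiffOn ℝ (closure Ω \ Γ) :=
  (uniqueDiffOn_convex hΩc.closure
    (hne.mono (interior_maximal subset_closure hΩ))).inter hΓ.isOpen_compl

theorem gradSupNorm_log_lt_top (hΩ : IsOpen Ω) (hb : Bornology.IsBounded Ω) (hΩc : Convex ℝ Ω)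
    (hne : Ω.Nonempty) (hf : IsC11On f (closure Ω)) (hf0 : ∀ x ∈ closure Ω, 0 < f x) :
    gradSupNorm (fun x => Real.log (f x)) Ω < ⊤ := by
  obtain ⟨C, hC⟩ := exists_bound_fderiv_of_contDiffOn hΩ subset_closure hb.isCompact_closure
    (uniqueDiffOn_convex hΩc.closure (hne.mono (interior_maximal subset_closure hΩ)))
    (hf.1.log fun x hx => (hf0 x hx).ne')
  refine eLpNorm_top_lt_top_of_bound hΩ.measurableSet (C := C) fun x hx => ?_
  rw [norm_gradient_eq]
  exact hC x hx

theorem hessSupNorm_log_lt_top (hΩ : IsOpen Ω) (hb : Bornology.IsBounded Ω) (hΩc : Convex ℝ Ω)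
    (hne : Ω.Nonempty) (hf : IsC11On f (closure Ω)) (hf0 : ∀ x ∈ closure Ω, 0 < f x) :
    hessSupNorm (fun x => Real.log (f x)) Ω < ⊤ := by
  obtain ⟨hf1, K, hK⟩ := hf
  obtain ⟨C, hC⟩ := exists_bound_sndFDeriv_log hΩ hΩc subset_closure hb.isCompact_closure
    (uniqueDiffOn_convex hΩc.closure (hne.mono (interior_maximal subset_closure hΩ))) hf1 hf0 hK
  refine eLpNorm_top_lt_top_of_bound hΩ.measurableSet (C := C) fun x hx => ?_
  rw [norm_iteratedFDeriv_two]
  exact hC x hx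

theorem gradSupNorm_lt_top_of_convexOn (hΩ : IsOpen Ω) (hb : Bornology.IsBounded Ω)
    (hΩc : Convex ℝ Ω) (hne : Ω.Nonempty) (hΓ : IsClosed Γ) (hΓΩ : Γ ⊆ Ω)
    (hc : ConvexOn ℝ (closure Ω) u) (hu : ContDiffOn ℝ 2 u (closure Ω \ Γ)) :
    gradSupNorm u Ω < ⊤ := by
  obtain ⟨C, hC⟩ := hc.exists_bound_fderiv hΩ hΓ hΓΩ hb.isCompact_closure
    (uniqueDiffOn_closure_sdiff hΩ hΩc hne hΓ) (hu.of_le (by norm_num))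
  refine eLpNorm_top_lt_top_of_bound hΩ.measurableSet (C := C) fun x hx => ?_
  rw [norm_gradient_eq]
  exact hC x hx

theorem notMem_of_mem_frontier (hΩ : IsOpen Ω) (hΓΩ : Γ ⊆ Ω) {x : EuclideanSpace ℝ (Fin n)}
    (hx : x ∈ frontier Ω) : x ∉ Γ := fun h => by
  rw [hΩ.frontier_eq] at hx
  exact hx.2 (hΓΩ h)

/-- The closed set `Γ` misses the frontier, so removing it changes nothing locally. This passes to
`closure Ω \ Γ`, where `u` is `C²`. -/
theorem iteratedFDerivWithin_closure_eq (hΩ : IsOpen Ω) (hΓ : IsClosed Γ) (hΓΩ : Γ ⊆ Ω)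
    {x : EuclideanSpace ℝ (Fin n)} (hx : x ∈ frontier Ω) :
    iteratedFDerivWithin ℝ 2 u (closure Ω) x = iteratedFDerivWithin ℝ 2 u (closure Ω \ Γ) x := by
  refine (iteratedFDerivWithin_inter_open (n := 2) hΓ.isOpen_compl
    (notMem_of_mem_frontier hΩ hΓΩ hx)).symm

theorem hessBoundarySupNorm_lt_top (hΩ : IsOpen Ω) (hb : Bornology.IsBounded Ω)
    (hΩc : Convex ℝ Ω) (hne : Ω.Nonempty) (hΓ : IsClosed Γ) (hΓΩ : Γ ⊆ Ω)
    (hu : ContDiffOn ℝ 2 u (closure Ω \ Γ)) : hessBoundarySupNorm u Ω < ⊤ := by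
  have hcomp : IsCompact (frontier Ω) :=
    hb.isCompact_closure.of_isClosed_subset isClosed_frontier frontier_subset_closure
  obtain ⟨C, hC⟩ := hcomp.exists_bound_of_continuousOn
    ((hu.continuousOn_iteratedFDerivWithin (m := 2) le_rfl
      (uniqueDiffOn_closure_sdiff hΩ hΩc hne hΓ)).mono fun x hx =>
        ⟨frontier_subset_closure hx, notMem_of_mem_frontier hΩ hΓΩ hx⟩)
  refine lt_of_le_of_lt (iSup₂_le (a := ENNReal.ofReal C) fun x hx => ?_) ENNReal.ofReal_lt_top
  rw [iteratedFDerivWithin_closure_eq hΩ hΓ hΓΩ hx, ← ofReal_norm]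
  exact ENNReal.ofReal_le_ofReal (hC x hx)

theorem norm_iteratedFDerivWithin_le_hessBoundarySupNorm (hfin : hessBoundarySupNorm u Ω < ⊤)
    {x : EuclideanSpace ℝ (Fin n)} (hx : x ∈ frontier Ω) :
    ‖iteratedFDerivWithin ℝ 2 u (closure Ω) x‖ ≤ (hessBoundarySupNorm u Ω).toReal := by
  have h : ‖iteratedFDerivWithin ℝ 2 u (closure Ω) x‖ₑ ≤ hessBoundarySupNorm u Ω :=
    le_iSup₂ (f := fun x (_ : x ∈ frontier Ω) => ‖iteratedFDerivWithin ℝ 2 u (closure Ω) x‖ₑ) x hx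
  simpa using ENNReal.toReal_mono hfin.ne h

/-- The Hessian estimate away from a closed convex set. -/
theorem norm_hess_le_hessBound_div (hΩ : IsOpen Ω) (hb : Bornology.IsBounded Ω)
    (hΩc : Convex ℝ Ω) (hΓ : IsClosed Γ) (hΓne : Γ.Nonempty) (hΓc : Convex ℝ Γ) (hΓΩ : Γ ⊆ Ω)
    (hf : IsC11On f (closure Ω)) (hf0 : ∀ x ∈ closure Ω, 0 < f x)
    (hc : ConvexOn ℝ (closure Ω) u) (hu2 : ContDiffOn ℝ 2 u (closure Ω \ Γ))
    (hu4 : ContDiffOn ℝ 4 u (Ω \ Γ)) (hdet : ∀ x ∈ Ω \ Γ, (hessianMatrix u x).det = f x)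
    {x : EuclideanSpace ℝ (Fin n)} (hx : x ∈ Ω \ Γ) :
    ‖iteratedFDeriv ℝ 2 u x‖ ≤
      hessBound (Metric.diam Ω, (gradSupNorm (fun x => Real.log (f x)) Ω).toReal,
        (hessSupNorm (fun x => Real.log (f x)) Ω).toReal, (gradSupNorm u Ω).toReal,
        (hessBoundarySupNorm u Ω).toReal) / Metric.infDist x Γ := by
  have hne : Ω.Nonempty := hΓne.mono hΓΩ
  have finA := gradSupNorm_log_lt_top hΩ hb hΩc hne hf hf0
  have finB := hessSupNorm_log_lt_top hΩ hb hΩc hne hf hf0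
  have finM := gradSupNorm_lt_top_of_convexOn hΩ hb hΩc hne hΓ hΓΩ hc hu2
  have finH := hessBoundarySupNorm_lt_top hΩ hb hΩc hne hΓ hΓΩ hu2
  set A := (gradSupNorm (fun x => Real.log (f x)) Ω).toReal with hAdef
  set B := (hessSupNorm (fun x => Real.log (f x)) Ω).toReal with hBdef
  set M := (gradSupNorm u Ω).toReal with hMdef
  set H := (hessBoundarySupNorm u Ω).toReal with hHdef
  have hA0 : 0 ≤ A := ENNReal.toReal_nonneg
  have hB0 : 0 ≤ B := ENNReal.toReal_nonneg
  have hM0 : 0 ≤ M := ENNReal.toReal_nonneg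
  have hH0 : 0 ≤ H := ENNReal.toReal_nonneg
  have hd0 : 0 ≤ Metric.diam Ω := Metric.diam_nonneg
  have hCeq : hessBound (Metric.diam Ω, A, B, M, H) = Real.exp (M ^ 2 / 2) *
      (1 + Metric.diam Ω ^ 2 * B + 2 * M + M * A * Metric.diam Ω + Metric.diam Ω * H) := by
    simp only [hessBound, max_eq_left hA0, max_eq_left hB0, max_eq_left hM0, max_eq_left hH0,
      max_eq_left hd0]
  set S := closure Ω \ Γ with hS
  set V := Ω \ Γ with hVdef
  have hV : IsOpen V := hΩ.sdiff hΓ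
  have hVΩ : V ⊆ Ω := Set.sdiff_subset
  have hVS : V ⊆ S := Set.sdiff_subset_sdiff_left subset_closure
  have hSu : UniqueDiffOn ℝ S := uniqueDiffOn_closure_sdiff hΩ hΩc hne hΓ
  have hSV : ∀ y ∈ V, S ∈ 𝓝 y := fun y hy => mem_of_superset (hV.mem_nhds hy) hVS
  have hu2V : ContDiffOn ℝ 2 u V := hu4.of_le (by norm_num)
  -- Although `f` is only assumed `C^{1,1}`, off `Γ` it equals the determinant of the Hessian of a
  -- `C⁴` function and so is `C²` there.
  have hh : ContDiffOn ℝ 2 (fun y => Real.log (f y)) V :=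
    ((contDiffOn_det_hessianMatrix hV hu4).congr fun y hy => (hdet y hy).symm).log fun y hy =>
      (hf0 y (subset_closure (hVΩ hy))).ne'
  have hdetpos : ∀ y ∈ V, 0 < (hessianMatrix u y).det := fun y hy => by
    rw [hdet y hy]
    exact hf0 y (subset_closure (hVΩ hy))
  have hconv : ∀ y ∈ V, ∀ v, 0 ≤ fderiv ℝ (fderiv ℝ u) y v v := fun y hy v =>
    hc.sndFDeriv_nonneg hV (hVΩ.trans subset_closure) hu2V hy v
  -- pointwise bounds
  have hgradCont : ∀ g : EuclideanSpace ℝ (Fin n) → ℝ, ContDiffOn ℝ 2 g V →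
      ContinuousOn (fun y => ∇ g y) V := fun g hg =>
    (InnerProductSpace.toDual ℝ (EuclideanSpace ℝ (Fin n))).symm.continuous.comp_continuousOn
      (hg.continuousOn_fderiv_of_isOpen hV (by norm_num))
  have hA : ∀ y ∈ V, ‖fderiv ℝ (fun y => Real.log (f y)) y‖ ≤ A := fun y hy => by
    rw [← norm_gradient_eq]
    exact norm_le_toReal_eLpNorm_top hV hVΩ (hgradCont _ hh) finA.ne hy
  have hMV : ∀ y ∈ V, ‖fderiv ℝ u y‖ ≤ M := fun y hy => by
    rw [← norm_gradient_eq]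
    exact norm_le_toReal_eLpNorm_top hV hVΩ (hgradCont _ hu2V) finM.ne hy
  have hB : ∀ y ∈ V, ∀ v, ‖v‖ = 1 →
      -B ≤ fderiv ℝ (fderiv ℝ fun y => Real.log (f y)) y v v := by
    intro y hy v hv
    have h1 : ‖iteratedFDeriv ℝ 2 (fun y => Real.log (f y)) y‖ ≤ B := by
      refine norm_le_toReal_eLpNorm_top hV hVΩ ?_ finB.ne hy
      refine (hh.continuousOn_iteratedFDerivWithin (m := 2) le_rfl hV.uniqueDiffOn).congr ?_
      exact fun z hz => (iteratedFDerivWithin_of_isOpen 2 hV hz).symm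
    rw [norm_iteratedFDeriv_two] at h1
    have h2 := (fderiv ℝ (fderiv ℝ fun y => Real.log (f y)) y).le_opNorm₂ v v
    rw [hv, mul_one, mul_one] at h2
    exact (abs_le.1 (h2.trans h1)).1
  -- the differentials up to the boundary
  set F₁ := fderivWithin ℝ u S with hF₁def
  set F₂ := fderivWithin ℝ F₁ S with hF₂def
  have hF₁S : ContDiffOn ℝ 1 F₁ S := hu2.fderivWithin hSu (by norm_num)
  have hF₁c : ContinuousOn F₁ S := hF₁S.continuousOn
  have hF₂c : ContinuousOn F₂ S := hF₁S.continuousOn_fderivWithin hSu (by norm_num)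
  have hF₁V : ∀ y ∈ V, F₁ y = fderiv ℝ u y := fun y hy => fderivWithin_of_mem_nhds (hSV y hy)
  have hF₂V : ∀ y ∈ V, F₂ y = fderiv ℝ (fderiv ℝ u) y := fun y hy => by
    rw [hF₂def, fderivWithin_of_mem_nhds (hSV y hy)]
    exact Filter.EventuallyEq.fderiv_eq (eventually_of_mem (hV.mem_nhds hy) hF₁V)
  have hfr : ∀ y ∈ S, y ∉ V → y ∈ frontier Ω := fun y hy hyV => by
    rw [hΩ.frontier_eq]
    exact ⟨hy.1, fun h => hyV ⟨h, hy.2⟩⟩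
  -- The gradient bound passes to the boundary by continuity, as `V` is dense in `S`.
  have hM : ∀ y ∈ S, ‖F₁ y‖ ≤ M := by
    intro y hy
    have hycl : y ∈ closure V := hΓ.isOpen_compl.closure_inter hy
    refine ContinuousWithinAt.closure_le hycl ((hF₁c y hy).norm.mono hVS)
      (continuousWithinAt_const (b := M)) fun z hz => ?_
    rw [hF₁V z hz]
    exact hMV z hz
  have hH : ∀ y ∈ S, y ∉ V → ∀ v, ‖v‖ = 1 → F₂ y v v ≤ H := by
    intro y hy hyV v hv
    have h1 := norm_iteratedFDerivWithin_le_hessBoundarySupNorm finH (hfr y hy hyV)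
    rw [iteratedFDerivWithin_closure_eq hΩ hΓ hΓΩ (hfr y hy hyV)] at h1
    have h2 := (iteratedFDerivWithin ℝ 2 u S y).le_opNorm ![v, v]
    rw [iteratedFDerivWithin_two_apply u hSu hy] at h2
    simp only [Matrix.cons_val_zero, Matrix.cons_val_one, Fin.prod_univ_two, hv, mul_one] at h2
    exact (le_abs_self _).trans (h2.trans h1)
  -- the cut-off
  have hdist : 0 < Metric.infDist x Γ := (hΓ.notMem_iff_infDist_pos hΓne).1 hx.2
  obtain ⟨p, hp, e, he, hex, heΓ⟩ := exists_unit_inner_le_of_convex hΓ hΓne hΓc hx.2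
  have main : ∀ ε, 0 < ε → ε < Metric.infDist x Γ → ∀ v, ‖v‖ = 1 →
      (Metric.infDist x Γ - ε) * fderiv ℝ (fderiv ℝ u) x v v
        ≤ hessBound (Metric.diam Ω, A, B, M, H) := by
    intro ε hε hεd v hv
    -- The hyperplane through `p` touches `Γ`; the shift by `ε` makes the cap `K` disjoint from `Γ`,
    -- so that `F₁` and `F₂` are continuous on it.
    set c := inner ℝ e p + ε with hcdef
    have hlc : Continuous fun y : EuclideanSpace ℝ (Fin n) => (inner ℝ e y - c : ℝ) := by fun_prop
    set K := {y | y ∈ closure Ω ∧ 0 ≤ inner ℝ e y - c} with hKdef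
    have hKc : IsCompact K :=
      hb.isCompact_closure.inter_right (isClosed_le continuous_const hlc)
    have hKS : K ⊆ S := fun y hy => ⟨hy.1, fun hyΓ => by
      have h1 := heΓ y hyΓ
      have h2 := hy.2
      rw [hcdef] at h2
      linarith⟩
    have hlx : inner ℝ e x - c = Metric.infDist x Γ - ε := by rw [hcdef, ← hex]; ring
    have hxK : x ∈ K := ⟨subset_closure hx.1, by rw [hlx]; linarith⟩
    have key := mul_hess_le_of_halfSpace (d := Metric.diam Ω) hV hu4 hh
      (fun y hy => by rw [hdet y hy]) hdetpos hconv he hKc (fun y hy => hy.2)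
      (fun y hy => by
        have h1 : inner ℝ e (y - p) ≤ ‖e‖ * ‖y - p‖ := real_inner_le_norm _ _
        have h2 : dist y p ≤ Metric.diam (closure Ω) :=
          Metric.dist_le_diam_of_mem hb.closure hy.1 (subset_closure (hΓΩ hp))
        rw [Metric.diam_closure, dist_eq_norm] at h2
        rw [inner_sub_right, he, one_mul] at h1
        rw [hcdef]
        linarith)
      (fun y hy hly => ⟨subset_closure hy.1, hly.le⟩) (hF₁c.mono hKS) (hF₂c.mono hKS) hF₁V hF₂V
      hA0 hB0 hM0 hH0 hA hB (fun y hy => hM y (hKS hy)) (fun y hy => hH y (hKS hy)) hxK hv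
    rwa [hlx, hF₂V x hx, ← hCeq] at key
  have hfin : ∀ v, ‖v‖ = 1 → fderiv ℝ (fderiv ℝ u) x v v
      ≤ hessBound (Metric.diam Ω, A, B, M, H) / Metric.infDist x Γ := by
    intro v hv
    rw [le_div_iff₀ hdist, mul_comm]
    have htend : Tendsto (fun ε : ℝ => (Metric.infDist x Γ - ε) * fderiv ℝ (fderiv ℝ u) x v v)
        (𝓝[>] 0) (𝓝 (Metric.infDist x Γ * fderiv ℝ (fderiv ℝ u) x v v)) := by
      have : Continuous fun ε : ℝ =>
          (Metric.infDist x Γ - ε) * fderiv ℝ (fderiv ℝ u) x v v := by fun_prop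
      have h := this.tendsto 0
      rw [sub_zero] at h
      exact h.mono_left nhdsWithin_le_nhds
    refine le_of_tendsto htend ?_
    filter_upwards [self_mem_nhdsWithin, mem_nhdsWithin_of_mem_nhds (Iio_mem_nhds hdist)]
      with ε h1 h2 using main ε h1 h2 v hv
  refine ContinuousMultilinearMap.opNorm_le_bound
    (div_nonneg (hessBound_pos _).le hdist.le) fun m => ?_
  rw [iteratedFDeriv_two_apply, Fin.prod_univ_two, ← mul_assoc]
  exact abs_apply_le_of_diag_le
    (fun v w => ((hu2V.contDiffAt (hV.mem_nhds hx)).isSymmSndFDerivAt (by simp)).eq v w)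
    (hconv x hx) hfin (m 0) (m 1)

end Data

theorem theorem4p2 (n : ℕ) (hn : 2 ≤ n) :
    ∃ C : ℝ × ℝ × ℝ × ℝ × ℝ → ℝ, Monotone C ∧ (∀ t, 0 < C t) ∧
      ∀ (Ω Γ : Set (EuclideanSpace ℝ (Fin n))) (f u : EuclideanSpace ℝ (Fin n) → ℝ),
        IsOpen Ω → Bornology.IsBounded Ω → Convex ℝ Ω → HasSmoothBoundary Ω →
        ((∃ a, Γ = {a}) ∨ ∃ a b, a ≠ b ∧ Γ = segment ℝ a b) → Γ ⊆ Ω →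
        IsC11On f (closure Ω) → (∀ x ∈ closure Ω, 0 < f x) →
        ConvexOn ℝ (closure Ω) u →
        ContDiffOn ℝ 2 u (closure Ω \ Γ) → ContDiffOn ℝ 4 u (Ω \ Γ) →
        (∀ x ∈ Ω \ Γ, (hessianMatrix u x).det = f x) →
        gradSupNorm (fun x => Real.log (f x)) Ω < ⊤ ∧
        hessSupNorm (fun x => Real.log (f x)) Ω < ⊤ ∧
        gradSupNorm u Ω < ⊤ ∧
        hessBoundarySupNorm u Ω < ⊤ ∧
        ∀ x ∈ Ω \ Γ, ‖iteratedFDeriv ℝ 2 u x‖ ≤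
          C (Metric.diam Ω,
            (gradSupNorm (fun x => Real.log (f x)) Ω).toReal,
            (hessSupNorm (fun x => Real.log (f x)) Ω).toReal,
            (gradSupNorm u Ω).toReal,
            (hessBoundarySupNorm u Ω).toReal) / Metric.infDist x Γ := by
  refine ⟨hessBound, hessBound_monotone, hessBound_pos, ?_⟩
  intro Ω Γ f u hΩ hb hΩc _ hΓ hΓΩ hf hf0 hc hu2 hu4 hdet
  -- Both shapes of `Γ` provide what separation by a hyperplane requires.
  have hΓ' : IsClosed Γ ∧ Γ.Nonempty ∧ Convex ℝ Γ := by
    rcases hΓ with ⟨a, rfl⟩ | ⟨a, b, -, rfl⟩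
    · exact ⟨isClosed_singleton, Set.singleton_nonempty a, convex_singleton a⟩
    · refine ⟨?_, ⟨a, left_mem_segment ℝ a b⟩, convex_segment a b⟩
      rw [← convexHull_pair]
      exact (Set.toFinite {a, b}).isClosed_convexHull ℝ
  obtain ⟨hΓcl, hΓne, hΓc⟩ := hΓ'
  have hne : Ω.Nonempty := hΓne.mono hΓΩ
  exact ⟨gradSupNorm_log_lt_top hΩ hb hΩc hne hf hf0, hessSupNorm_log_lt_top hΩ hb hΩc hne hf hf0,
    gradSupNorm_lt_top_of_convexOn hΩ hb hΩc hne hΓcl hΓΩ hc hu2,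
    hessBoundarySupNorm_lt_top hΩ hb hΩc hne hΓcl hΓΩ hu2, fun x hx =>
    norm_hess_le_hessBound_div hΩ hb hΩc hΓcl hΓne hΓc hΓΩ hf hf0 hc hu2 hu4 hdet hx⟩
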